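/- A (correlation) scenario $S=(I,M,O)$ consists of a finite set $I$ of parties with $|I|\ge 2$, for each $i\in I$ a finite set $M_i$ of inputs with $|M_i|\ge 2$, and for each input $x_i\in M_i$ a finite set $O_{x_i}$ of outputs with $|O_{x_i}|\ge 2$. For $\vec x\in\prod_i M_i$ put $O_{\vec x}=\prod_i O_{x_i}$. A behaviour is a family $\wp=\{\wp(\vec a|\vec x)\}$ of real numbers such that $\wp(\cdot|\vec x)$ is a probability distribution on $O_{\vec x}$ for every $\vec x$. For $V\subseteq I$, $\wp(\vec a_V|\vec x)$ denotes the marginal on the outputs of the parties in $V$. Define the following sets of behaviours. * $\mathbf{NS}(S)$ (no-signalling): $\wp(\vec a_{I\setminus\{i\}}|\vec x)=\wp(\vec a_{I\setminus\{i\}}|\vec x')$ whenever $\vec x$ and $\vec x'$ differ only in the input of party $i$. * $\mathbf{B}(S)$ (Bell-local): $\wp(\vec a|\vec x)=\int_\Lambda \prod_{i\in I}P(a_i|x_i,\lambda)\,d\mu(\lambda)$ for some probability space $(\Lambda,\mu)$ and some probability distributions $P(\cdot|x_i,\lambda)$ on $O_{x_i}$ that depend measurably on $\lambda$. * $\mathbf{Q}(S)$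 (quantum): $\wp(\vec a|\vec x)=\mathrm{tr}\big[\big(\bigotimes_{i\in I}E_{a_i|x_i}\big)\rho\big]$ for some complex Hilbert spaces $\mathcal H_i$ (of arbitrary dimension), some positive operator $\rho$ of unit trace on $\bigotimes_{i\in I}\mathcal H_i$, and some positive bounded operators $E_{a_i|x_i}$ on $\mathcal H_i$ with $\sum_{a_i\in O_{x_i}}E_{a_i|x_i}=\mathrm{id}_{\mathcal H_i}$ for all $i$ and all $x_i\in M_i$. * For a collection $M'$ of subsets $M'_i\subseteq M_i$ ($i\in I$), $\mathbf{PD}(S,M')$ (partially deterministic): the convex hull of the set of all $\wp\in\mathbf{NS}(S)$ such that $\wp(\vec a_V|\vec x)\in\{0,1\}$ for all $\vec x$, all $V\subseteq\{i\in I: x_i\in M'_i\}$ and all $\vec a_V$. **Theorem.** Let $S=(I,M,O)$ be such a scenario and let $M'$ be a collection of subsets $M'_i\subseteq M_i$, $i\in I$. Then exactly one of the following three statements holds. 1. $\mathbf{PD}(S,M')=\mathbf{B}(S)\subsetneq\mathbf{Q}(S)$. 2. $\mathbf{PD}(S,M')=\mathbf{NS}(S)\supsetneq\mathbf{Q}(S)$.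 3. $\mathbf{B}(S)\ne\mathbf{PD}(S,M')\ne\mathbf{NS}(S)$, and both $\mathbf{Q}(S)\not\subseteq\mathbf{PD}(S,M')$ and $\mathbf{PD}(S,M')\not\subseteq\mathbf{Q}(S)$. -/

import Mathlib

open scoped InnerProductSpace

namespace BellScenario

/-! A scenario consists of a finite type `I` of parties, input types `M i`, and output types
`O i m` for every input `m : M i`. -/

section Behaviours

variable {I : Type*} {M : I → Type*}

/-- A family of real numbers `p x a`, written `℘(a | x)` on paper, indexed by input strings `x` and
output strings `a` for the inputs `x`. -/
abbrev Table (O : ∀ i, M i → Type*) : Type _ :=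
  ∀ x : (∀ i, M i), (∀ i, O i (x i)) → ℝ

variable [Fintype I] [DecidableEq I] (O : ∀ i, M i → Type*) [∀ i m, Fintype (O i m)]

/-- `E(S)`: all behaviours. -/
def allBehaviours : Set (Table O) :=
  {p | (∀ x a, 0 ≤ p x a) ∧ ∀ x, ∑ a, p x a = 1}

variable {O}

open Classical in
/-- The marginal `℘(a_V | x)`; only the entries of `a` at parties in `V` matter. -/
noncomputable def marginal (p : Table O) (V : Set I) (x : ∀ i, M i) (a : ∀ i, O i (x i)) : ℝ :=
  ∑ b with ∀ i ∈ V, b i = a i, p x b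

variable (O)

/-- `NS(S)`: the no-signalling behaviours. If `x` and `y` differ only at party `i`, then the
marginals on the other parties agree. To speak of one and the same output substring in both
contexts, it is written as the evaluation at `x`, respectively at `y`, of an assignment `α` of
outputs to all inputs; the entry at party `i` is irrelevant. -/
def noSignalling : Set (Table O) :=
  {p | p ∈ allBehaviours O ∧ ∀ (i : I) (x y : ∀ j, M j), (∀ j, j ≠ i → x j = y j) →
    ∀ α : (∀ j (m : M j), O j m),
      marginal p {i}ᶜ x (fun j => α j (x j)) = marginal p {i}ᶜ y (fun j => α j (y j))}

/-- `PP(S, M')`: the behaviours that are predictable with respect to the inputs in `M'`; the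
marginal on any set of parties whose inputs lie in `M'` takes only the values `0` and `1`. -/
def partiallyPredictable (M' : ∀ i, Set (M i)) : Set (Table O) :=
  {p | p ∈ allBehaviours O ∧ ∀ (x : ∀ i, M i) (V : Set I), V ⊆ {i | x i ∈ M' i} →
    ∀ a, marginal p V x a = 0 ∨ marginal p V x a = 1}

/-- `PD(S, M')`: the convex hull of the no-signalling behaviours that are predictable with
respect to `M'`. -/
def partiallyDeterministic (M' : ∀ i, Set (M i)) : Set (Table O) :=
  convexHull ℝ (partiallyPredictable O M' ∩ noSignalling O)

/-- `B(S)`: the Bell-local behaviours, which have a factorizable local hidden variable model with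
hidden variable `l : Λ` distributed according to `μ`, and local response distributions
`P i m l`. -/
def bellLocal : Set (Table O) :=
  {p | p ∈ allBehaviours O ∧
    ∃ (Λ : Type) (_ : MeasurableSpace Λ) (μ : MeasureTheory.Measure Λ)
      (P : ∀ (i : I) (m : M i), Λ → O i m → ℝ),
      MeasureTheory.IsProbabilityMeasure μ ∧
      (∀ i m a, Measurable fun l => P i m l a) ∧
      (∀ i m l a, 0 ≤ P i m l a) ∧
      (∀ i m l, ∑ a, P i m l a = 1) ∧
      ∀ x a, p x a = ∫ l, ∏ i, P i (x i) l (a i) ∂μ}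

end Behaviours

section Operators

/-- `τ` exhibits the Hilbert space `K` as the (completed) tensor product of the Hilbert spaces
`H i`, where `τ v` is the elementary tensor of the vectors `v i`: inner products of elementary
tensors are the products of the inner products of the factors, and the elementary tensors span a
dense subspace. This determines `K` and `τ` up to a unique unitary. -/
structure IsHilbertTensorProduct {I : Type*} [Fintype I] {H : I → Type*}
    [∀ i, NormedAddCommGroup (H i)] [∀ i, InnerProductSpace ℂ (H i)]
    {K : Type*} [NormedAddCommGroup K] [InnerProductSpace ℂ K]
    (τ : MultilinearMap ℂ H K) : Prop where
  inner_eq : ∀ v w : (∀ i, H i), ⟪τ v, τ w⟫_ℂ = ∏ i, ⟪v i, w i⟫_ℂ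
  dense : Dense (Submodule.span ℂ (Set.range τ) : Set K)

/-- `T` is the tensor product of the bounded operators `A i`: it is the bounded operator that maps
the elementary tensor of the `v i` to the elementary tensor of the `A i (v i)`. -/
def IsTensorOperator {I : Type*} {H : I → Type*}
    [∀ i, NormedAddCommGroup (H i)] [∀ i, InnerProductSpace ℂ (H i)]
    {K : Type*} [NormedAddCommGroup K] [InnerProductSpace ℂ K]
    (τ : MultilinearMap ℂ H K) (A : ∀ i, H i →L[ℂ] H i) (T : K →L[ℂ] K) : Prop :=
  ∀ v, T (τ v) = τ fun i => A i (v i)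

/-- The bounded operator `A` is of trace class with trace `t`: the sum of the diagonal entries
converges unconditionally to `t` in every orthonormal basis. -/
def HasTrace {K : Type} [NormedAddCommGroup K] [InnerProductSpace ℂ K]
    (A : K →L[ℂ] K) (t : ℂ) : Prop :=
  ∀ (ι : Type) (b : HilbertBasis ι ℂ K), HasSum (fun j => ⟪b j, A (b j)⟫_ℂ) t

end Operators

section Quantum

variable {I : Type*} {M : I → Type*} [Fintype I] [DecidableEq I]
  (O : ∀ i, M i → Type*) [∀ i m, Fintype (O i m)]

/-- The data of a quantum model: local Hilbert spaces of arbitrary dimension, their tensor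
product, a density operator on it, and local positive operator valued measures. -/
structure QuantumModel where
  H : I → Type
  [normedH : ∀ i, NormedAddCommGroup (H i)]
  [innerH : ∀ i, InnerProductSpace ℂ (H i)]
  [completeH : ∀ i, CompleteSpace (H i)]
  K : Type
  [normedK : NormedAddCommGroup K]
  [innerK : InnerProductSpace ℂ K]
  [completeK : CompleteSpace K]
  τ : MultilinearMap ℂ H K
  isTensor : IsHilbertTensorProduct τ
  ρ : K →L[ℂ] K
  ρ_pos : ρ.IsPositive
  ρ_trace : HasTrace ρ 1
  E : ∀ (i : I) (m : M i), O i m → (H i →L[ℂ] H i)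
  E_pos : ∀ i m a, (E i m a).IsPositive
  E_sum : ∀ i m, ∑ a, E i m a = ContinuousLinearMap.id ℂ (H i)

attribute [instance] QuantumModel.normedH QuantumModel.innerH QuantumModel.completeH
  QuantumModel.normedK QuantumModel.innerK QuantumModel.completeK

/-- `Q(S)`: the quantum behaviours, given by the Born rule `℘(a | x) = tr[(⨂ᵢ E(aᵢ | xᵢ)) ρ]`. -/
def quantum : Set (Table O) :=
  {p | p ∈ allBehaviours O ∧ ∃ q : QuantumModel O, ∀ x a, ∃ T : q.K →L[ℂ] q.K,
    IsTensorOperator q.τ (fun i => q.E i (x i) (a i)) T ∧ HasTrace (T ∘L q.ρ) (p x a : ℂ)}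

end Quantum

/-- Exactly one of three propositions holds. -/
def ExactlyOne (A B C : Prop) : Prop :=
  (A ∧ ¬B ∧ ¬C) ∨ (¬A ∧ B ∧ ¬C) ∨ (¬A ∧ ¬B ∧ C)

end BellScenario

namespace BellScenario

open scoped Classical ComplexOrder

/-! ### Marginals and no-signalling. -/

section Marginals

variable {I : Type*} {M : I → Type*} [Fintype I] [DecidableEq I]
  {O : ∀ i, M i → Type*} [∀ i m, Fintype (O i m)]

/-! Call an input of party `i` free if it lies outside `M' i`. The inclusions B ⊆ Q ⊆ NS and B ⊆ PD
⊆ NS always hold. The case is decided by how many parties have two or more free inputs, and by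
whether any input is not free.

Suppose that at most one party `k` has two free inputs. In a generator of PD, every other party `i`
has at most one input `z i` whose output is not fixed in advance, so the joint outcome at these
inputs can serve as hidden variable. Given its value, only `k` still responds at random, and by
no-signalling the weight of the value does not depend on the input of `k`. Hence PD = B
(`partiallyDeterministic_subset_bellLocal`).

If two parties have two free inputs each, a Popescu-Rohrlich box on these inputs, with constant
outputs elsewhere, lies in PD (`prBox_mem_partiallyDeterministic`). It is not quantum
(`prBox_notMem_quantum`): its perfect correlations identify the effects of the two parties on the
range of the state, and its anticorrelation then annihilates the state. Hence PD ⊄ Q.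

If some input is not free, a Clauser-Horne inequality containing it holds on PD, because a single
predetermined output suffices to derive it (`clauserHorne_nonpos`). Measurements on an entangled
pair of qubits violate it, so Q ⊄ PD (`exists_mem_quantum_notMem_partiallyDeterministic`). If all
inputs are free, the predictability condition is void and PD = NS.

The strict inclusions B ⊂ Q and Q ⊂ NS come from the same two constructions, applied with no input
free and with all inputs free. -/

theorem marginal_eq_sum (p : Table O) (V : Set I) (x : ∀ i, M i) (a : ∀ i, O i (x i)) :
    marginal p V x a = ∑ b, if ∀ i ∈ V, b i = a i then p x b else 0 := by
  unfold marginal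
  rw [Finset.sum_filter]

theorem marginal_add (p q : Table O) (V : Set I) (x : ∀ i, M i) (a : ∀ i, O i (x i)) :
    marginal (p + q) V x a = marginal p V x a + marginal q V x a := by
  simp only [marginal_eq_sum, ← Finset.sum_add_distrib]
  refine Finset.sum_congr rfl fun c _ => ?_
  split_ifs <;> simp

theorem marginal_smul (c : ℝ) (p : Table O) (V : Set I) (x : ∀ i, M i) (a : ∀ i, O i (x i)) :
    marginal (c • p) V x a = c * marginal p V x a := by
  simp only [marginal_eq_sum, Finset.mul_sum]
  refine Finset.sum_congr rfl fun c _ => ?_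
  split_ifs <;> simp

theorem marginal_univ (p : Table O) (x : ∀ i, M i) (a : ∀ i, O i (x i)) :
    marginal p Set.univ x a = p x a := by
  rw [marginal_eq_sum, Finset.sum_eq_single a]
  · simp
  · intro b _ hb
    rw [if_neg fun h => hb (funext fun i => h i (Set.mem_univ i))]
  · simp

theorem marginal_empty {p : Table O} (hp : p ∈ allBehaviours O) (x : ∀ i, M i)
    (a : ∀ i, O i (x i)) : marginal p ∅ x a = 1 := by
  rw [marginal_eq_sum]
  simpa using hp.2 x

theorem marginal_nonneg {p : Table O} (hp : p ∈ allBehaviours O) (V : Set I) (x : ∀ i, M i)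
    (a : ∀ i, O i (x i)) : 0 ≤ marginal p V x a := by
  rw [marginal_eq_sum]
  refine Finset.sum_nonneg fun b _ => ?_
  split_ifs
  · exact hp.1 x b
  · exact le_rfl

theorem marginal_anti {p : Table O} (hp : p ∈ allBehaviours O) {V W : Set I} (h : V ⊆ W)
    (x : ∀ i, M i) (a : ∀ i, O i (x i)) : marginal p W x a ≤ marginal p V x a := by
  simp only [marginal_eq_sum]
  refine Finset.sum_le_sum fun b _ => ?_
  by_cases hW : ∀ i ∈ W, b i = a i
  · rw [if_pos hW, if_pos fun i hi => hW i (h hi)]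
  · rw [if_neg hW]
    split_ifs
    · exact hp.1 x b
    · exact le_rfl

/-- The global assignment `α`, with the output at input `m` of party `i` changed to `o`. -/
noncomputable def setOutput (α : ∀ i m, O i m) (i : I) (m : M i) (o : O i m) : ∀ i m, O i m :=
  Function.update α i (Function.update (α i) m o)

omit [Fintype I] [∀ i m, Fintype (O i m)] in
@[simp] theorem setOutput_same (α : ∀ i m, O i m) (i : I) (m : M i) (o : O i m) :
    setOutput α i m o i m = o := by
  simp [setOutput]

omit [Fintype I] [∀ i m, Fintype (O i m)] in
theorem setOutput_of_ne (α : ∀ i m, O i m) {i j : I} (h : j ≠ i) (m : M i) (o : O i m) :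
    setOutput α i m o j = α j := by
  simp [setOutput, h]

omit [Fintype I] [DecidableEq I] [∀ i m, Fintype (O i m)] in
-- Global assignments give outputs in all contexts at once, so contexts whose inputs agree only
-- propositionally can be compared without casts.
theorem exists_eval_eq [∀ i m, Nonempty (O i m)] (x : ∀ i, M i) (a : ∀ i, O i (x i)) :
    ∃ α : ∀ i m, O i m, (fun i => α i (x i)) = a := by
  refine ⟨fun i m => if h : x i = m then h ▸ a i else Classical.arbitrary _, ?_⟩
  funext i
  simp

theorem marginal_eq_sum_insert (p : Table O) {V : Set I} {i : I} (hi : i ∉ V) {x : ∀ i, M i}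
    {m : M i} (hm : x i = m) (α : ∀ i m, O i m) :
    marginal p V x (fun j => α j (x j)) =
      ∑ o, marginal p (insert i V) x (fun j => setOutput α i m o j (x j)) := by
  subst hm
  simp only [marginal_eq_sum]
  rw [Finset.sum_comm]
  refine Finset.sum_congr rfl fun b _ => ?_
  have key : ∀ o, (∀ j ∈ insert i V, b j = setOutput α i (x i) o j (x j)) ↔
      (b i = o ∧ ∀ j ∈ V, b j = α j (x j)) := by
    intro o
    rw [Set.forall_mem_insert, setOutput_same]
    refine and_congr Iff.rfl (forall₂_congr fun j hj => ?_)
    rw [setOutput_of_ne _ (by rintro rfl; exact hi hj)]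
  simp only [key, ite_and]
  simp

/-- No-signalling is postulated only for the marginal on `{i}ᶜ`; smaller marginals inherit it by
summing out further parties. -/
theorem marginal_eq_of_eq_off {p : Table O} (hp : p ∈ noSignalling O) (V : Set I) {i : I}
    (hi : i ∉ V) {x y : ∀ i, M i} (hxy : ∀ j, j ≠ i → x j = y j) (α : ∀ i m, O i m) :
    marginal p V x (fun j => α j (x j)) = marginal p V y (fun j => α j (y j)) := by
  -- `D` contains the parties other than `i` that may still be missing from `V`; for empty `D` the
  -- set `V` is exactly `{i}ᶜ`.
  have key : ∀ (D : Finset I) (V : Set I), i ∉ V → (∀ j, j ≠ i → j ∈ V ∨ j ∈ D) →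
      ∀ α : (∀ i m, O i m),
      marginal p V x (fun j => α j (x j)) = marginal p V y (fun j => α j (y j)) := by
    intro D
    induction D using Finset.induction_on with
    | empty =>
      intro V hi hV α
      have : V = {i}ᶜ := by
        ext j
        refine ⟨fun hj h => hi (h ▸ hj), fun h => (hV j h).resolve_right (by simp)⟩
      subst this
      exact hp.2 i x y hxy α
    | insert k D _ ih =>
      intro V hi hV α
      by_cases hk : k ∈ V ∨ k = i
      · refine ih V hi (fun j hj => ?_) α
        rcases hV j hj with h | h
        · exact Or.inl h
        · rcases Finset.mem_insert.1 h with rfl | h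
          · exact Or.inl (hk.resolve_right hj)
          · exact Or.inr h
      · push Not at hk
        rw [marginal_eq_sum_insert p hk.1 rfl, marginal_eq_sum_insert p hk.1 (hxy k hk.2).symm]
        refine Finset.sum_congr rfl fun o _ => ih _ ?_ ?_ _
        · rintro (h | h)
          · exact hk.2 h.symm
          · exact hi h
        · intro j hj
          rcases hV j hj with h | h
          · exact Or.inl (Or.inr h)
          · rcases Finset.mem_insert.1 h with rfl | h
            · exact Or.inl (Or.inl rfl)
            · exact Or.inr h
  exact key Finset.univ V hi (fun j _ => Or.inr (Finset.mem_univ j)) α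

/-- The inputs outside `V` are changed one party at a time. -/
theorem marginal_eq_of_eqOn {p : Table O} (hp : p ∈ noSignalling O) (V : Set I)
    {x y : ∀ i, M i} (hxy : ∀ j ∈ V, x j = y j) (α : ∀ i m, O i m) :
    marginal p V x (fun j => α j (x j)) = marginal p V y (fun j => α j (y j)) := by
  have key : ∀ (D : Finset I) (x : ∀ i, M i), (∀ j ∈ V, x j = y j) → (∀ j ∉ D, x j = y j) →
      marginal p V x (fun j => α j (x j)) = marginal p V y (fun j => α j (y j)) := by
    intro D
    induction D using Finset.induction_on with
    | empty =>
      intro x _ h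
      obtain rfl : x = y := funext fun j => h j (by simp)
      rfl
    | insert k D _ ih =>
      intro x hV h
      by_cases hk : k ∈ V
      · refine ih x hV fun j hj => ?_
        by_cases hjk : j = k
        · subst hjk
          exact hV j hk
        · exact h j (by simp [hjk, hj])
      · rw [marginal_eq_of_eq_off hp V hk (y := Function.update x k (y k))
          (fun j hj => by simp [hj])]
        refine ih _ (fun j hj => ?_) (fun j hj => ?_)
        · rw [Function.update_of_ne (by rintro rfl; exact hk hj)]
          exact hV j hj
        · by_cases hjk : j = k
          · subst hjk
            simp
          · rw [Function.update_of_ne hjk]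
            exact h j (by simp [hjk, hj])
  exact key Finset.univ x hxy (fun j hj => absurd (Finset.mem_univ j) hj)

/-- The one-party marginal at a predictable input is a point mass, and by no-signalling it is the
same point mass in every context. -/
theorem exists_deterministic_output [∀ i, Nonempty (M i)] [∀ i m, Nonempty (O i m)]
    {M' : ∀ i, Set (M i)} {p : Table O} (hp : p ∈ partiallyPredictable O M' ∩ noSignalling O)
    {i : I} {m : M i} (hm : m ∈ M' i) :
    ∃ o : O i m, ∀ (x : ∀ i, M i) (α : ∀ i m, O i m), x i = m → α i m ≠ o →
      p x (fun j => α j (x j)) = 0 := by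
  obtain ⟨hpp, hns⟩ := hp
  let x₀ : ∀ i, M i := Function.update (fun i => Classical.arbitrary (M i)) i m
  have hx₀ : x₀ i = m := by simp [x₀]
  let α₀ : ∀ i m, O i m := fun i m => Classical.arbitrary _
  have hsum := marginal_eq_sum_insert p (Set.notMem_empty i) hx₀ α₀
  rw [marginal_empty hpp.1, insert_empty_eq] at hsum
  obtain ⟨o, ho⟩ : ∃ o, marginal p {i} x₀ (fun j => setOutput α₀ i m o j (x₀ j)) ≠ 0 := by
    by_contra! h
    simp [h] at hsum
  replace ho := (hpp.2 x₀ {i} (by simpa [hx₀] using hm) _).resolve_left ho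
  refine ⟨o, fun x α hx hα => ?_⟩
  have h1 : marginal p {i} x (fun j => setOutput α₀ i m o j (x j)) = 1 := by
    rw [← ho]
    exact marginal_eq_of_eqOn hns _ (by simp [hx, hx₀]) _
  subst hx
  have h2 := hns.1.2 x
  rw [marginal_eq_sum] at h1
  simp only [Set.mem_singleton_iff, forall_eq, setOutput_same] at h1
  have h3 : ∑ b, (p x b - if b i = o then p x b else 0) = 0 := by
    rw [Finset.sum_sub_distrib, h1, h2, sub_self]
  rw [Finset.sum_eq_zero_iff_of_nonneg] at h3
  · have := h3 (fun j => α j (x j)) (Finset.mem_univ _)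
    rwa [if_neg hα, sub_zero] at this
  · intro b _
    split_ifs
    · simp
    · simpa using hns.1.1 x b

theorem marginal_pair_le {p : Table O} (hp : p ∈ allBehaviours O) (i j : I) (x : ∀ i, M i)
    (a : ∀ i, O i (x i)) :
    marginal p {j} x a + marginal p {i} x a ≤ 1 + marginal p {i, j} x a := by
  rw [← hp.2 x]
  simp only [marginal_eq_sum, ← Finset.sum_add_distrib]
  refine Finset.sum_le_sum fun b _ => ?_
  have := hp.1 x b
  simp only [Set.mem_singleton_iff, forall_eq, Set.mem_insert_iff, forall_eq_or_imp]
  by_cases h1 : b i = a i <;> by_cases h2 : b j = a j <;> simp [h1, h2, this]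

end Marginals

/-! ### Response tables, convexity and the Clauser-Horne inequality. -/

section Response

variable {I : Type*} {M : I → Type*} [Fintype I] [DecidableEq I]
  {O : ∀ i, M i → Type*} [∀ i m, Fintype (O i m)] {U : Type*} [Fintype U]

/-- The table in which, for the inputs `x`, the outputs are read off from the global assignment
`out u` with weight `W x u`. -/
noncomputable def responseTable (W : (∀ i, M i) → U → ℝ) (out : U → ∀ i m, O i m) : Table O :=
  fun x a => ∑ u, if (fun i => out u i (x i)) = a then W x u else 0

theorem marginal_responseTable (W : (∀ i, M i) → U → ℝ) (out : U → ∀ i m, O i m) (V : Set I)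
    (x : ∀ i, M i) (a : ∀ i, O i (x i)) :
    marginal (responseTable W out) V x a =
      ∑ u, if ∀ i ∈ V, out u i (x i) = a i then W x u else 0 := by
  simp only [marginal_eq_sum, responseTable, ← Finset.sum_filter]
  rw [Finset.sum_filter]
  simp only [Finset.sum_filter]
  calc _ = ∑ b, ∑ u, (if (fun i => out u i (x i)) = b then
          (if ∀ i ∈ V, out u i (x i) = a i then W x u else 0) else 0) := by
        refine Finset.sum_congr rfl fun b _ => ?_
        by_cases hb : ∀ i ∈ V, b i = a i
        · rw [if_pos hb]
          refine Finset.sum_congr rfl fun u _ => ?_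
          by_cases hu : (fun i => out u i (x i)) = b
          · subst hu
            rw [if_pos rfl, if_pos rfl, if_pos hb]
          · rw [if_neg hu, if_neg hu]
        · rw [if_neg hb]
          symm
          refine Finset.sum_eq_zero fun u _ => ?_
          by_cases hu : (fun i => out u i (x i)) = b
          · subst hu
            rw [if_pos rfl, if_neg hb]
          · rw [if_neg hu]
    _ = _ := by
        rw [Finset.sum_comm]
        simp

theorem sum_responseTable (W : (∀ i, M i) → U → ℝ) (out : U → ∀ i m, O i m) (x : ∀ i, M i) :
    ∑ a, responseTable W out x a = ∑ u, W x u := by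
  simp only [responseTable]
  rw [Finset.sum_comm]
  simp

theorem responseTable_mem_allBehaviours {W : (∀ i, M i) → U → ℝ} (out : U → ∀ i m, O i m)
    (h0 : ∀ x u, 0 ≤ W x u) (h1 : ∀ x, ∑ u, W x u = 1) :
    responseTable W out ∈ allBehaviours O := by
  refine ⟨fun x a => Finset.sum_nonneg fun u _ => ?_, fun x => ?_⟩
  · split_ifs
    · exact h0 x u
    · exact le_rfl
  · rw [sum_responseTable, h1]

theorem convex_allBehaviours : Convex ℝ (allBehaviours O) := by
  intro p hp q hq a b ha hb hab
  refine ⟨fun x o => ?_, fun x => ?_⟩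
  · exact add_nonneg (mul_nonneg ha (hp.1 x o)) (mul_nonneg hb (hq.1 x o))
  · simp [Finset.sum_add_distrib, ← Finset.mul_sum, hp.2 x, hq.2 x, hab]

theorem convex_noSignalling : Convex ℝ (noSignalling O) := by
  intro p hp q hq a b ha hb hab
  refine ⟨convex_allBehaviours hp.1 hq.1 ha hb hab, fun i x y hxy α => ?_⟩
  simp only [marginal_add, marginal_smul, hp.2 i x y hxy α, hq.2 i x y hxy α]

theorem partiallyDeterministic_subset_noSignalling (M' : ∀ i, Set (M i)) :
    partiallyDeterministic O M' ⊆ noSignalling O :=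
  convexHull_min Set.inter_subset_right convex_noSignalling

theorem noSignalling_subset_partiallyDeterministic {M' : ∀ i, Set (M i)} (h : ∀ i, M' i = ∅) :
    noSignalling O ⊆ partiallyDeterministic O M' := by
  intro p hp
  refine subset_convexHull ℝ _ ⟨⟨hp.1, fun x V hV a => ?_⟩, hp⟩
  obtain rfl : V = ∅ := by
    ext i
    simpa [h] using @hV i
  exact Or.inr (marginal_empty hp.1 x a)

/-- The Clauser-Horne expression for the parties `i` and `j`, the input strings `X m n` and the
outputs given by the global assignment `α`. -/
noncomputable def clauserHorne (i j : I) (m₀ m₁ : M i) (n₀ n₁ : M j) (X : M i → M j → ∀ k, M k)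
    (α : ∀ k m, O k m) (p : Table O) : ℝ :=
  marginal p {i, j} (X m₀ n₀) (fun k => α k (X m₀ n₀ k)) +
    marginal p {i, j} (X m₀ n₁) (fun k => α k (X m₀ n₁ k)) +
    marginal p {i, j} (X m₁ n₀) (fun k => α k (X m₁ n₀ k)) -
    marginal p {i, j} (X m₁ n₁) (fun k => α k (X m₁ n₁ k)) -
    marginal p {i} (X m₀ n₀) (fun k => α k (X m₀ n₀ k)) -
    marginal p {j} (X m₀ n₀) (fun k => α k (X m₀ n₀ k))

/-- The expression is linear, so generators suffice. There the output at `m₀` has probability 0 or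
1. If 0, the two positive terms with `m₀` vanish and the third is at most the marginal of `j`. If 1,
inclusion-exclusion at `(m₁, n₁)` bounds what remains. -/
theorem clauserHorne_nonpos {M' : ∀ i, Set (M i)} {p : Table O}
    (hp : p ∈ partiallyDeterministic O M') {i j : I} {m₀ : M i} (hm₀ : m₀ ∈ M' i)
    (m₁ : M i) (n₀ n₁ : M j) (X : M i → M j → ∀ k, M k) (hXi : ∀ m n, X m n i = m)
    (hXj : ∀ m n, X m n j = n) (α : ∀ k m, O k m) :
    clauserHorne i j m₀ m₁ n₀ n₁ X α p ≤ 0 := by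
  suffices h : partiallyDeterministic O M' ⊆
      {p | clauserHorne i j m₀ m₁ n₀ n₁ X α p ≤ 0} from h hp
  refine convexHull_min ?_ ?_
  · rintro p ⟨hpp, hns⟩
    have hi : ∀ m n n', marginal p {i} (X m n) (fun k => α k (X m n k)) =
        marginal p {i} (X m n') (fun k => α k (X m n' k)) :=
      fun m n n' => marginal_eq_of_eqOn hns _ (by simp [hXi]) α
    have hj : ∀ m m' n, marginal p {j} (X m n) (fun k => α k (X m n k)) =
        marginal p {j} (X m' n) (fun k => α k (X m' n k)) :=
      fun m m' n => marginal_eq_of_eqOn hns _ (by simp [hXj]) α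
    have hli : ∀ m n, marginal p {i, j} (X m n) (fun k => α k (X m n k)) ≤
        marginal p {i} (X m n) (fun k => α k (X m n k)) :=
      fun m n => marginal_anti hns.1 (by simp) _ _
    have hlj : ∀ m n, marginal p {i, j} (X m n) (fun k => α k (X m n k)) ≤
        marginal p {j} (X m n) (fun k => α k (X m n k)) :=
      fun m n => marginal_anti hns.1 (by simp) _ _
    have h0 : ∀ V m n, 0 ≤ marginal p V (X m n) (fun k => α k (X m n k)) :=
      fun V m n => marginal_nonneg hns.1 _ _ _
    have hpair := marginal_pair_le hns.1 i j (X m₁ n₁) (fun k => α k (X m₁ n₁ k))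
    rcases hpp.2 (X m₀ n₀) {i} (by simpa [hXi] using hm₀) (fun k => α k (X m₀ n₀ k)) with h | h
    · have := hli m₀ n₀
      have := hli m₀ n₁
      have := hi m₀ n₀ n₁
      have := hlj m₁ n₀
      have := hj m₀ m₁ n₀
      have := h0 {i, j} m₁ n₁
      simp only [Set.mem_ofPred_eq, clauserHorne]
      linarith
    · have := hlj m₀ n₀
      have := hlj m₀ n₁
      have := hj m₀ m₁ n₁
      have := hli m₁ n₀
      have := hi m₁ n₀ n₁
      simp only [Set.mem_ofPred_eq, clauserHorne]
      linarith
  · intro p hp q hq a b ha hb hab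
    simp only [Set.mem_ofPred_eq, clauserHorne, marginal_add, marginal_smul] at hp hq ⊢
    nlinarith [mul_le_mul_of_nonneg_left hp ha, mul_le_mul_of_nonneg_left hq hb]

end Response

/-! ### Bell-local behaviours as mixtures of deterministic ones. -/

section Local

variable {I : Type*} {M : I → Type*} [Fintype I] [DecidableEq I] [∀ i, Fintype (M i)]
  {O : ∀ i, M i → Type*} [∀ i m, Fintype (O i m)]

/-- A table is local if it is a nonnegative combination of deterministic response functions. -/
def IsLocal (p : Table O) : Prop :=
  ∃ w : (∀ i m, O i m) → ℝ, (∀ g, 0 ≤ w g) ∧ p = responseTable (fun _ => w) id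

theorem IsLocal.zero : IsLocal (0 : Table O) :=
  ⟨0, fun _ => le_rfl, by funext x a; simp [responseTable]⟩

theorem IsLocal.add {p q : Table O} (hp : IsLocal p) (hq : IsLocal q) : IsLocal (p + q) := by
  obtain ⟨v, hv, rfl⟩ := hp
  obtain ⟨w, hw, rfl⟩ := hq
  refine ⟨v + w, fun g => add_nonneg (hv g) (hw g), ?_⟩
  funext x a
  simp only [responseTable, Pi.add_apply, ← Finset.sum_add_distrib]
  refine Finset.sum_congr rfl fun g _ => ?_
  split_ifs <;> simp

theorem IsLocal.smul {c : ℝ} (hc : 0 ≤ c) {p : Table O} (hp : IsLocal p) : IsLocal (c • p) := by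
  obtain ⟨w, hw, rfl⟩ := hp
  refine ⟨c • w, fun g => mul_nonneg hc (hw g), ?_⟩
  funext x a
  simp [responseTable, Finset.mul_sum]

theorem IsLocal.sum {ι : Type*} (s : Finset ι) {p : ι → Table O} (hp : ∀ i, IsLocal (p i)) :
    IsLocal (∑ i ∈ s, p i) := by
  induction s using Finset.induction_on with
  | empty => simpa using IsLocal.zero
  | insert i s hi ih =>
    rw [Finset.sum_insert hi]
    exact (hp i).add ih

/-- The product weight of a family of local response distributions. -/
noncomputable def productWeight (P : ∀ (i : I) (m : M i), O i m → ℝ) (g : ∀ i m, O i m) : ℝ :=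
  ∏ i, ∏ m, P i m (g i m)

omit [DecidableEq I] [∀ i m, Fintype (O i m)] in
theorem productWeight_nonneg {P : ∀ (i : I) (m : M i), O i m → ℝ} (h0 : ∀ i m o, 0 ≤ P i m o)
    (g : ∀ i m, O i m) : 0 ≤ productWeight P g :=
  Finset.prod_nonneg fun _ _ => Finset.prod_nonneg fun _ _ => h0 _ _ _

/-- Drawing the outputs at all inputs independently in advance reproduces independent responses,
since the unused inputs sum to one. -/
theorem responseTable_productWeight {P : ∀ (i : I) (m : M i), O i m → ℝ}
    (hP : ∀ i m, ∑ o, P i m o = 1) (x : ∀ i, M i) (a : ∀ i, O i (x i)) :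
    responseTable (fun _ => productWeight P) id x a = ∏ i, P i (x i) (a i) := by
  -- The constraint at party `i` is absorbed into the factor of its input `x i`, so that the sum
  -- over assignments factorizes.
  let Q : ∀ (i : I) (m : M i), O i m → ℝ := fun i =>
    Function.update (P i) (x i) fun o => if o = a i then P i (x i) o else 0
  have h1 : ∀ g : (∀ i m, O i m), (if (fun i => g i (x i)) = a then productWeight P g else 0) =
      ∏ i, ∏ m, Q i m (g i m) := by
    intro g
    by_cases h : (fun i => g i (x i)) = a
    · rw [if_pos h]
      refine Finset.prod_congr rfl fun i _ => Finset.prod_congr rfl fun m _ => ?_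
      by_cases hm : m = x i
      · subst hm
        have hi : g i (x i) = a i := congrFun h i
        simp [Q, hi]
      · simp [Q, hm]
    · rw [if_neg h]
      obtain ⟨i, hi⟩ : ∃ i, g i (x i) ≠ a i := by
        by_contra! h'
        exact h (funext h')
      symm
      refine Finset.prod_eq_zero (Finset.mem_univ i) (Finset.prod_eq_zero (Finset.mem_univ (x i)) ?_)
      simp [Q, hi]
  have h2 : ∀ i, ∑ h : (∀ m, O i m), ∏ m, Q i m (h m) = P i (x i) (a i) := by
    intro i
    have := Finset.prod_univ_sum (fun m => (Finset.univ : Finset (O i m))) (fun m o => Q i m o)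
    rw [Fintype.piFinset_univ] at this
    rw [← this, Finset.prod_eq_single (x i)]
    · simp [Q]
    · intro m _ hm
      simp [Q, hm, hP]
    · simp
  have h3 := Finset.prod_univ_sum (fun i => (Finset.univ : Finset (∀ m, O i m)))
    (fun i h => ∏ m, Q i m (h m))
  rw [Fintype.piFinset_univ] at h3
  simp only [h2] at h3
  rw [h3]
  exact Finset.sum_congr rfl fun g _ => h1 g

theorem isLocal_prod {P : ∀ (i : I) (m : M i), O i m → ℝ} (h0 : ∀ i m o, 0 ≤ P i m o)
    (hP : ∀ i m, ∑ o, P i m o = 1) : IsLocal (fun x a => ∏ i, P i (x i) (a i) : Table O) :=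
  ⟨productWeight P, productWeight_nonneg h0,
    by funext x a; rw [responseTable_productWeight hP]⟩

/-- Fine's argument: all local randomness can be moved into a finite hidden variable, the global
assignment of outputs, whose weight is the integral of the product weight. -/
theorem mem_bellLocal_iff [∀ i, Nonempty (M i)] {p : Table O} :
    p ∈ bellLocal O ↔ p ∈ allBehaviours O ∧ IsLocal p := by
  constructor
  · rintro ⟨hp, Λ, _, μ, P, hμ, hmeas, h0, h1, h⟩
    refine ⟨hp, fun g => ∫ l, productWeight (fun i m => P i m l) g ∂μ, fun g =>
      MeasureTheory.integral_nonneg fun l => productWeight_nonneg (fun _ _ _ => h0 _ _ _ _) g, ?_⟩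
    have hle : ∀ i m l a, P i m l a ≤ 1 := fun i m l a => by
      rw [← h1 i m l]
      exact Finset.single_le_sum (fun b _ => h0 i m l b) (Finset.mem_univ a)
    have hint : ∀ g, MeasureTheory.Integrable (fun l => productWeight (fun i m => P i m l) g) μ := by
      intro g
      refine MeasureTheory.Integrable.of_bound (C := 1) ?_ (Filter.Eventually.of_forall fun l => ?_)
      · refine Measurable.aestronglyMeasurable ?_
        exact Finset.measurable_prod _ fun i _ => Finset.measurable_prod _ fun m _ => hmeas _ _ _
      · rw [Real.norm_of_nonneg (productWeight_nonneg (fun _ _ _ => h0 _ _ _ _) g)]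
        exact Finset.prod_le_one (fun _ _ => Finset.prod_nonneg fun _ _ => h0 _ _ _ _)
          fun _ _ => Finset.prod_le_one (fun _ _ => h0 _ _ _ _) fun _ _ => hle _ _ _ _
    funext x a
    rw [h]
    have : ∀ l, ∏ i, P i (x i) l (a i) = ∑ g : (∀ i m, O i m),
        if (fun i => g i (x i)) = a then productWeight (fun i m => P i m l) g else 0 :=
      fun l => (responseTable_productWeight (fun i m => h1 i m l) x a).symm
    simp only [this]
    rw [MeasureTheory.integral_finsetSum]
    · refine Finset.sum_congr rfl fun g _ => ?_
      simp only [id]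
      split_ifs <;> simp
    · intro g _
      split_ifs
      · exact hint g
      · simp
  · rintro ⟨hp, w, hw, rfl⟩
    refine ⟨hp, ?_⟩
    -- Hidden variable spaces must lie in `Type`, whatever the universes of the scenario; hence the
    -- relabelling by `Fin`.
    let e := (Fintype.equivFin (∀ i m, O i m)).symm
    have hsum : ∑ g, w g = 1 := by
      rw [← hp.2 fun i => Classical.arbitrary (M i), sum_responseTable]
    let ν : PMF (Fin (Fintype.card (∀ i m, O i m))) :=
      PMF.ofFintype (fun k => ENNReal.ofReal (w (e k))) (by
        rw [← ENNReal.ofReal_sum_of_nonneg fun k _ => hw _, e.sum_comp, hsum, ENNReal.ofReal_one])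
    refine ⟨_, inferInstance, ν.toMeasure, fun i m k o => if e k i m = o then 1 else 0,
      inferInstance, fun i m a => measurable_of_finite _, fun i m k a => ?_, fun i m k => ?_,
      fun x a => ?_⟩
    · dsimp only
      split_ifs <;> simp
    · simp
    · rw [PMF.integral_eq_sum]
      simp only [responseTable]
      rw [← e.sum_comp]
      refine Finset.sum_congr rfl fun k _ => ?_
      rw [Finset.prod_ite_zero]
      simp only [id, funext_iff, Finset.mem_univ, true_implies, ν, PMF.ofFintype_apply,
        ENNReal.toReal_ofReal (hw _)]
      split_ifs <;> simp

theorem convex_bellLocal [∀ i, Nonempty (M i)] : Convex ℝ (bellLocal O) := by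
  intro p hp q hq a b ha hb hab
  rw [mem_bellLocal_iff] at hp hq ⊢
  exact ⟨convex_allBehaviours hp.1 hq.1 ha hb hab, (hp.2.smul ha).add (hq.2.smul hb)⟩

theorem bellLocal_subset_partiallyDeterministic [∀ i, Nonempty (M i)] (M' : ∀ i, Set (M i)) :
    bellLocal O ⊆ partiallyDeterministic O M' := by
  intro p hp
  obtain ⟨hb, w, hw, rfl⟩ := mem_bellLocal_iff.1 hp
  have hsum : ∑ g, w g = 1 := by
    rw [← hb.2 fun i => Classical.arbitrary (M i), sum_responseTable]
  let det : (∀ i m, O i m) → Table O := fun g => responseTable (fun _ (_ : Unit) => 1) fun _ => g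
  have hmarg : ∀ g V x a, marginal (det g) V x a = if ∀ i ∈ V, g i (x i) = a i then 1 else 0 := by
    intro g V x a
    simp only [det]
    rw [marginal_responseTable]
    simp
  have hdet : ∀ g, det g ∈ allBehaviours O := fun g =>
    responseTable_mem_allBehaviours _ (by simp) (by simp)
  have : responseTable (fun _ => w) id = ∑ g, w g • det g := by
    funext x a
    simp [responseTable, det, Finset.sum_apply]
  rw [this]
  refine (convex_convexHull ℝ _).sum_mem (fun g _ => hw g) hsum fun g _ =>
    subset_convexHull ℝ _ ⟨⟨hdet g, fun x V _ a => ?_⟩, hdet g, fun i x y hxy α => ?_⟩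
  · rw [hmarg]
    split_ifs <;> simp
  · rw [hmarg, hmarg]
    congr 1
    exact propext (forall₂_congr fun j hj => by rw [hxy j hj])

end Local

/-! ### Locality when at most one party has several free inputs. -/

section OneFreeParty

variable {I : Type*} {M : I → Type*} [Fintype I] [DecidableEq I]
  {O : ∀ i, M i → Type*}

/-- The global assignment that agrees with `b` at the inputs `z` of the parties other than `k`,
and with `d` elsewhere. -/
noncomputable def mergeOutput (z : ∀ i, M i) (k : I) (d : ∀ i m, O i m)
    (b : ∀ i : {i // i ≠ k}, O i (z i)) : ∀ i m, O i m :=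
  fun i m => if h : i ≠ k ∧ m = z i then h.2 ▸ b ⟨i, h.1⟩ else d i m

omit [Fintype I] in
theorem mergeOutput_same (z : ∀ i, M i) (k : I) (d : ∀ i m, O i m)
    (b : ∀ i : {i // i ≠ k}, O i (z i)) (i : {i // i ≠ k}) :
    mergeOutput z k d b i (z i) = b i := by
  simp [mergeOutput, i.2]

omit [Fintype I] in
theorem mergeOutput_of_ne (z : ∀ i, M i) (k : I) (d : ∀ i m, O i m)
    (b : ∀ i : {i // i ≠ k}, O i (z i)) {i : I} {m : M i} (h : m ≠ z i) :
    mergeOutput z k d b i m = d i m := by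
  simp [mergeOutput, h]

variable [∀ i m, Fintype (O i m)]

/-- Parties with `x i ≠ z i` produce the fixed output `d`, so only the marginal on `k` and the
parties with `x i = z i` matters. No-signalling moves it to the context `z` with the input of `k`
replaced, where it is expanded over the joint outcomes `b` of the others. -/
theorem eq_sum_mergeOutput [∀ i m, Nonempty (O i m)] {p : Table O} (hp : p ∈ noSignalling O)
    (z : ∀ i, M i) (k : I) (d : ∀ i m, O i m)
    (hd : ∀ (i : I) (m : M i), i ≠ k → m ≠ z i → ∀ (x : ∀ i, M i) (α : ∀ i m, O i m),
      x i = m → α i m ≠ d i m → p x (fun j => α j (x j)) = 0)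
    (x : ∀ i, M i) (α : ∀ i m, O i m) :
    p x (fun i => α i (x i)) = ∑ b : (∀ i : {i // i ≠ k}, O i (z i)),
      if ∀ i, i ≠ k → mergeOutput z k d b i (x i) = α i (x i) then
        p (Function.update z k (x k)) (fun i => setOutput (mergeOutput z k d b) k (x k)
          (α k (x k)) i (Function.update z k (x k) i)) else 0 := by
  set y := Function.update z k (x k) with hy
  have hyk : y k = x k := by simp [y]
  have hyi : ∀ i, i ≠ k → y i = z i := fun i hi => by simp [y, hi]
  let W : Set I := {i | i = k ∨ x i = z i}
  have hW : ∀ i ∈ W, x i = y i := by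
    intro i hi
    by_cases hik : i = k
    · subst hik
      exact hyk.symm
    · rw [hyi i hik]
      exact hi.resolve_left hik
  have h1 : p x (fun i => α i (x i)) = if ∀ i, i ≠ k → x i ≠ z i → α i (x i) = d i (x i) then
      marginal p W x (fun i => α i (x i)) else 0 := by
    split_ifs with h
    · rw [marginal_eq_sum, Finset.sum_eq_single (fun i => α i (x i))]
      · simp
      · intro c _ hc
        split_ifs with hcW
        · obtain ⟨γ, rfl⟩ := exists_eval_eq x c
          obtain ⟨i, hi⟩ : ∃ i, γ i (x i) ≠ α i (x i) := by
            by_contra! h'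
            exact hc (funext h')
          have hiW : i ∉ W := fun h' => hi (hcW i h')
          simp only [W, Set.mem_ofPred_eq, not_or] at hiW
          exact hd i (x i) hiW.1 hiW.2 x γ rfl (by rwa [← h i hiW.1 hiW.2])
        · rfl
      · simp
    · push Not at h
      obtain ⟨i, hik, hiz, hi⟩ := h
      exact hd i (x i) hik hiz x α rfl hi
  have h2 : marginal p W x (fun i => α i (x i)) = marginal p W y (fun i => α i (y i)) :=
    marginal_eq_of_eqOn hp W hW α
  let Φ : (∀ i : {i // i ≠ k}, O i (z i)) → ∀ i, O i (y i) := fun b i =>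
    setOutput (mergeOutput z k d b) k (x k) (α k (x k)) i (y i)
  have hΦk : ∀ b, Φ b k = α k (y k) := by
    intro b
    have : ∀ m, m = x k → setOutput (mergeOutput z k d b) k (x k) (α k (x k)) k m = α k m := by
      rintro m rfl
      simp
    exact this _ hyk
  have hΦi : ∀ b i, i ≠ k → Φ b i = mergeOutput z k d b i (y i) := by
    intro b i hi
    simp only [Φ]
    rw [setOutput_of_ne _ hi]
  have hinj : Function.Injective Φ := by
    intro b b' h
    funext i
    have h' : mergeOutput z k d b i (y i) = mergeOutput z k d b' i (y i) := by
      rw [← hΦi b i i.2, ← hΦi b' i i.2, h]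
    have : ∀ m, m = z i → mergeOutput z k d b i m = mergeOutput z k d b' i m →
        b i = b' i := by
      rintro m rfl
      rw [mergeOutput_same, mergeOutput_same]
      exact id
    exact this _ (hyi i i.2) h'
  have hsurj : ∀ c : (∀ i, O i (y i)), c k = α k (y k) → ∃ b, Φ b = c := by
    intro c hc
    obtain ⟨γ, rfl⟩ := exists_eval_eq y c
    refine ⟨fun i => γ i (z i), ?_⟩
    funext i
    by_cases hik : i = k
    · subst hik
      rw [hΦk]
      exact hc.symm
    · rw [hΦi _ _ hik]
      have : ∀ m, m = z i → mergeOutput z k d (fun i => γ i (z i)) i m = γ i m := by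
        rintro m rfl
        exact mergeOutput_same z k d (fun i => γ i (z i)) ⟨i, hik⟩
      exact this _ (hyi i hik)
  have h3 : marginal p W y (fun i => α i (y i)) =
      ∑ b, if ∀ i ∈ W, Φ b i = α i (y i) then p y (Φ b) else 0 := by
    rw [marginal_eq_sum]
    symm
    refine Fintype.sum_of_injective Φ hinj _ _ ?_ fun _ => by congr
    intro c hc
    rw [if_neg]
    intro h
    obtain ⟨b, hb⟩ := hsurj c (h k (Or.inl rfl))
    exact hc ⟨b, hb⟩
  rw [h1, h2, h3]
  have key : ∀ b, (∀ i, i ≠ k → mergeOutput z k d b i (x i) = α i (x i)) ↔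
      ((∀ i, i ≠ k → x i ≠ z i → α i (x i) = d i (x i)) ∧ ∀ i ∈ W, Φ b i = α i (y i)) := by
    intro b
    have e : ∀ i ∈ W, i ≠ k → (Φ b i = α i (y i) ↔ mergeOutput z k d b i (x i) = α i (x i)) := by
      intro i hi hik
      rw [hΦi b i hik, hW i hi]
    constructor
    · intro h
      refine ⟨fun i hik hiz => ?_, fun i hi => ?_⟩
      · rw [← h i hik, mergeOutput_of_ne _ _ _ _ hiz]
      · by_cases hik : i = k
        · subst hik
          exact hΦk b
        · exact (e i hi hik).2 (h i hik)
    · rintro ⟨hd', hW'⟩ i hik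
      by_cases hi : x i = z i
      · exact (e i (Or.inr hi) hik).1 (hW' i (Or.inr hi))
      · rw [mergeOutput_of_ne _ _ _ _ hi, hd' i hik hi]
  simp only [key, ite_and]
  split_ifs
  · rfl
  · simp

variable [∀ i, Fintype (M i)]

/-- For a fixed outcome of the other parties, the weights of the outputs of `k` have a total `c`
that is independent of the input of `k`. Dividing by `c` gives a response distribution for `k`; the
other parties are deterministic. -/
theorem isLocal_of_one_free_party [∀ i m, Nonempty (O i m)] {p : Table O}
    (hp : p ∈ noSignalling O) (z : ∀ i, M i) (k : I) (β : ∀ i m, O i m) :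
    IsLocal (fun x a => if ∀ i, i ≠ k → β i (x i) = a i then
      p (Function.update z k (x k)) (fun i => setOutput β k (x k) (a k) i
        (Function.update z k (x k) i)) else 0 : Table O) := by
  let r : ∀ (i : I) (m : M i), O i m → ℝ := fun i m o =>
    p (Function.update z i m) (fun j => setOutput β i m o j (Function.update z i m j))
  have hr0 : ∀ i m o, 0 ≤ r i m o := fun i m o => hp.1.1 _ _
  let c := marginal p {k}ᶜ z (fun i => β i (z i))
  have hrc : ∀ m, ∑ o, r k m o = c := by
    intro m
    have h1 := marginal_eq_of_eqOn hp ({k}ᶜ) (x := z) (y := Function.update z k m)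
      (fun j hj => by rw [Function.update_of_ne hj]) β
    have h2 := marginal_eq_sum_insert p (V := {k}ᶜ) (i := k) (by simp)
      (x := Function.update z k m) (m := m) (by simp) β
    have h3 : insert k ({k}ᶜ : Set I) = Set.univ := by
      ext j
      simp [em]
    rw [h3] at h2
    simp only [marginal_univ] at h2
    rw [← h2, ← h1]
  have hc0 : 0 ≤ c := marginal_nonneg hp.1 _ _ _
  rcases hc0.eq_or_lt with hc | hc
  · convert IsLocal.zero (O := O) using 1
    funext x a
    have h : ∑ o, r k (x k) o = 0 := by rw [hrc, hc]
    rw [Finset.sum_eq_zero_iff_of_nonneg (fun o _ => hr0 _ _ _)] at h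
    have := h (a k) (Finset.mem_univ _)
    simp only [r] at this
    rw [this]
    simp
  · let P : ∀ (i : I) (m : M i), O i m → ℝ := fun i m o =>
      if i = k then r i m o / c else if β i m = o then 1 else 0
    have hP0 : ∀ i m o, 0 ≤ P i m o := by
      intro i m o
      simp only [P]
      split_ifs
      · exact div_nonneg (hr0 _ _ _) hc0
      · exact zero_le_one
      · exact le_rfl
    have hP1 : ∀ i m, ∑ o, P i m o = 1 := by
      intro i m
      by_cases hik : i = k
      · subst hik
        simp [P, ← Finset.sum_div, hrc, hc.ne']
      · simp [P, hik]
    convert (isLocal_prod hP0 hP1).smul hc0 using 1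
    funext x a
    rw [Pi.smul_apply, Pi.smul_apply, smul_eq_mul,
      ← Finset.mul_prod_erase _ _ (Finset.mem_univ k)]
    have h1 : ∏ i ∈ Finset.univ.erase k, P i (x i) (a i) =
        if ∀ i, i ≠ k → β i (x i) = a i then 1 else 0 := by
      rw [Finset.prod_congr rfl (g := fun i => if β i (x i) = a i then 1 else 0)
        (fun i hi => by simp [P, Finset.ne_of_mem_erase hi]), Finset.prod_ite_zero]
      simp
    rw [h1]
    have h2 : P k (x k) (a k) = r k (x k) (a k) / c := by simp [P]
    rw [h2]
    split_ifs
    · simp only [r]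
      field_simp
    · simp

theorem partiallyDeterministic_subset_bellLocal [∀ i, Nonempty (M i)]
    [∀ i m, Nonempty (O i m)] {M' : ∀ i, Set (M i)} (k : I)
    (hk : ∀ i, i ≠ k → ((M' i)ᶜ).Subsingleton) :
    partiallyDeterministic O M' ⊆ bellLocal O := by
  refine convexHull_min (fun p hp => mem_bellLocal_iff.2 ⟨hp.2.1, ?_⟩) convex_bellLocal
  -- `z i` is the only possible free input of `i`. Where there is none, and for `k`, whose entry
  -- gets overwritten, any input will do.
  have hz : ∀ i, ∃ z : M i, i ≠ k → ∀ m, m ≠ z → m ∈ M' i := by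
    intro i
    by_cases hik : i = k
    · exact ⟨Classical.arbitrary _, fun h => absurd hik h⟩
    · rcases (hk i hik).eq_empty_or_singleton with h | ⟨z, h⟩
      · exact ⟨Classical.arbitrary _, fun _ m _ => by simp [Set.compl_empty_iff.1 h]⟩
      · refine ⟨z, fun _ m hm => ?_⟩
        by_contra hm'
        exact hm (by simpa [h] using (show m ∈ (M' i)ᶜ from hm'))
  choose z hz using hz
  have hd : ∀ (i : I) (m : M i), ∃ o : O i m, i ≠ k → m ≠ z i → ∀ (x : ∀ i, M i)
      (α : ∀ i m, O i m), x i = m → α i m ≠ o → p x (fun j => α j (x j)) = 0 := by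
    intro i m
    by_cases h : i ≠ k ∧ m ≠ z i
    · obtain ⟨o, ho⟩ := exists_deterministic_output hp (hz i h.1 m h.2)
      exact ⟨o, fun _ _ => ho⟩
    · exact ⟨Classical.arbitrary _, fun h1 h2 => absurd ⟨h1, h2⟩ h⟩
  choose d hd using hd
  convert IsLocal.sum Finset.univ
    (fun b => isLocal_of_one_free_party hp.2 z k (mergeOutput z k d b)) using 1
  funext x a
  obtain ⟨α, rfl⟩ := exists_eval_eq x a
  rw [eq_sum_mergeOutput hp.2 z k d hd x α]
  simp only [Finset.sum_apply]

end OneFreeParty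

/-! ### The Popescu-Rohrlich box. -/

section PRWeight

variable {A B : Type*}

/-- The weights of a Popescu-Rohrlich box at the inputs `m₀`, `m₁` and `n₀`, `n₁`; all other
inputs have the output `true`. -/
noncomputable def prWeight (m₀ m₁ : A) (n₀ n₁ : B) (m : A) (n : B) (u : Bool × Bool) : ℝ :=
  ∑ r : Bool, if u = (if m = m₀ ∨ m = m₁ then r else true,
    if n = n₀ ∨ n = n₁ then xor r (decide (m = m₁ ∧ n = n₁)) else true) then 1 / 2 else 0

theorem prWeight_nonneg (m₀ m₁ : A) (n₀ n₁ : B) (m : A) (n : B) (u : Bool × Bool) :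
    0 ≤ prWeight m₀ m₁ n₀ n₁ m n u := by
  refine Finset.sum_nonneg fun r _ => ?_
  split_ifs <;> norm_num

theorem sum_prWeight (m₀ m₁ : A) (n₀ n₁ : B) (m : A) (n : B) :
    ∑ u, prWeight m₀ m₁ n₀ n₁ m n u = 1 := by
  simp only [prWeight]
  rw [Finset.sum_comm]
  simp

/-- The result does not involve `m`, which is one direction of no-signalling. -/
theorem sum_prWeight_left (m₀ m₁ : A) (n₀ n₁ : B) (m : A) (n : B) (v : Bool) :
    ∑ u, prWeight m₀ m₁ n₀ n₁ m n (u, v) =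
      if n = n₀ ∨ n = n₁ then 1 / 2 else if v = true then 1 else 0 := by
  by_cases h1 : m = m₀ ∨ m = m₁ <;> by_cases h2 : n = n₀ ∨ n = n₁ <;>
    by_cases h3 : m = m₁ ∧ n = n₁ <;> cases v <;>
    simp [prWeight, h1, h2, h3]

theorem sum_prWeight_right (m₀ m₁ : A) (n₀ n₁ : B) (m : A) (n : B) (u : Bool) :
    ∑ v, prWeight m₀ m₁ n₀ n₁ m n (u, v) =
      if m = m₀ ∨ m = m₁ then 1 / 2 else if u = true then 1 else 0 := by
  by_cases h1 : m = m₀ ∨ m = m₁ <;> by_cases h2 : n = n₀ ∨ n = n₁ <;>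
    by_cases h3 : m = m₁ ∧ n = n₁ <;> cases u <;>
    simp [prWeight, h1, h2, h3]

end PRWeight

/-! ### Embedding two-party boxes into the scenario. -/

section Box

variable {I : Type*} {M : I → Type*} [Fintype I] [DecidableEq I]
  {O : ∀ i, M i → Type*} [∀ i m, Fintype (O i m)]

/-- The global assignment in which the party `i` outputs the bit `u.1`, the party `j` the bit
`u.2`, and all others `true`, where bits are encoded into outputs by `enc`. -/
def bitOutput (enc : ∀ i m, Bool → O i m) (i j : I) (u : Bool × Bool) : ∀ i m, O i m :=
  fun l m => enc l m (if l = i then u.1 else if l = j then u.2 else true)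

/-- The table in which parties `i` and `j` output bits distributed according to `W`, and the
other parties output `true`. -/
noncomputable def boxTable (enc : ∀ i m, Bool → O i m) (i j : I)
    (W : M i → M j → Bool × Bool → ℝ) : Table O :=
  responseTable (fun x => W (x i) (x j)) (bitOutput enc i j)

variable {enc : ∀ i m, Bool → O i m} {i j : I} {W : M i → M j → Bool × Bool → ℝ}

theorem boxTable_mem_allBehaviours (h0 : ∀ m n u, 0 ≤ W m n u) (h1 : ∀ m n, ∑ u, W m n u = 1) :
    boxTable enc i j W ∈ allBehaviours O :=
  responseTable_mem_allBehaviours _ (fun _ => h0 _ _) (fun _ => h1 _ _)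

theorem boxTable_mem_noSignalling (hij : i ≠ j) (h0 : ∀ m n u, 0 ≤ W m n u)
    (h1 : ∀ m n, ∑ u, W m n u = 1)
    (hi : ∀ m m' n v, ∑ u, W m n (u, v) = ∑ u, W m' n (u, v))
    (hj : ∀ m n n' u, ∑ v, W m n (u, v) = ∑ v, W m n' (u, v)) :
    boxTable enc i j W ∈ noSignalling O := by
  refine ⟨boxTable_mem_allBehaviours h0 h1, fun l x y hxy α => ?_⟩
  simp only [boxTable]
  rw [marginal_responseTable, marginal_responseTable]
  have h2 : ∀ u, (∀ k ∈ ({l}ᶜ : Set I), bitOutput enc i j u k (x k) = α k (x k)) ↔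
      (∀ k ∈ ({l}ᶜ : Set I), bitOutput enc i j u k (y k) = α k (y k)) :=
    fun u => forall₂_congr fun k hk => by rw [hxy k hk]
  simp only [h2]
  by_cases hli : l = i
  · subst hli
    rw [Fintype.sum_prod_type_right, Fintype.sum_prod_type_right]
    refine Finset.sum_congr rfl fun v _ => ?_
    have h3 : ∀ u, (∀ k ∈ ({l}ᶜ : Set I), bitOutput enc l j (u, v) k (y k) = α k (y k)) ↔
        (∀ k ∈ ({l}ᶜ : Set I), bitOutput enc l j (true, v) k (y k) = α k (y k)) :=
      fun u => forall₂_congr fun k hk => by simp [bitOutput, show k ≠ l from hk]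
    simp only [h3]
    split_ifs
    · rw [hxy j hij.symm]
      exact hi _ _ _ _
    · rfl
  · by_cases hlj : l = j
    · subst hlj
      rw [Fintype.sum_prod_type, Fintype.sum_prod_type]
      refine Finset.sum_congr rfl fun u _ => ?_
      have h3 : ∀ v, (∀ k ∈ ({l}ᶜ : Set I), bitOutput enc i l (u, v) k (y k) = α k (y k)) ↔
          (∀ k ∈ ({l}ᶜ : Set I), bitOutput enc i l (u, true) k (y k) = α k (y k)) :=
        fun v => forall₂_congr fun k hk => by simp [bitOutput, show k ≠ l from hk]
      simp only [h3]
      split_ifs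
      · rw [hxy i hij]
        exact hj _ _ _ _
      · rfl
    · rw [hxy i (Ne.symm hli), hxy j (Ne.symm hlj)]
      refine Finset.sum_congr rfl fun u _ => ?_
      congr

theorem boxTable_mem_partiallyPredictable {M' : ∀ i, Set (M i)} (h0 : ∀ m n u, 0 ≤ W m n u)
    (h1 : ∀ m n, ∑ u, W m n u = 1)
    (hi : ∀ m ∈ M' i, ∀ n u, W m n u ≠ 0 → u.1 = true)
    (hj : ∀ n ∈ M' j, ∀ m u, W m n u ≠ 0 → u.2 = true) :
    boxTable enc i j W ∈ partiallyPredictable O M' := by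
  refine ⟨boxTable_mem_allBehaviours h0 h1, fun x V hV a => ?_⟩
  simp only [boxTable]
  rw [marginal_responseTable]
  -- On the support of `W`, predictable inputs yield `true`, so the event on `V` does not depend on
  -- `u` and the marginal is 0 or the total weight 1.
  have h2 : ∀ u, (if ∀ l ∈ V, bitOutput enc i j u l (x l) = a l then W (x i) (x j) u else 0) =
      if ∀ l ∈ V, bitOutput enc i j (true, true) l (x l) = a l then W (x i) (x j) u else 0 := by
    intro u
    by_cases hu : W (x i) (x j) u = 0
    · simp [hu]
    · congr 1
      refine propext (forall₂_congr fun l hl => ?_)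
      by_cases hli : l = i
      · subst hli
        simp [bitOutput, hi _ (hV hl) _ _ hu]
      · by_cases hlj : l = j
        · subst hlj
          simp [bitOutput, hli, hj _ (hV hl) _ _ hu]
        · simp [bitOutput, hli, hlj]
  simp only [h2]
  split_ifs
  · exact Or.inr (h1 _ _)
  · simp

/-- Every input in `M'` avoids the four chosen ones and therefore has the constant output `true`. -/
theorem prBox_mem_partiallyDeterministic {M' : ∀ i, Set (M i)} (hij : i ≠ j) {m₀ m₁ : M i}
    {n₀ n₁ : M j} (hm₀ : m₀ ∉ M' i) (hm₁ : m₁ ∉ M' i) (hn₀ : n₀ ∉ M' j) (hn₁ : n₁ ∉ M' j) :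
    boxTable enc i j (prWeight m₀ m₁ n₀ n₁) ∈ partiallyDeterministic O M' := by
  refine subset_convexHull ℝ _ ⟨boxTable_mem_partiallyPredictable (prWeight_nonneg _ _ _ _)
    (sum_prWeight _ _ _ _) ?_ ?_, boxTable_mem_noSignalling hij (prWeight_nonneg _ _ _ _)
    (sum_prWeight _ _ _ _) (fun m m' n v => ?_) (fun m n n' u => ?_)⟩
  · intro m hm n u hu
    by_contra hu'
    have h : ¬(m = m₀ ∨ m = m₁) := by rintro (rfl | rfl) <;> contradiction
    refine hu (Finset.sum_eq_zero fun r _ => if_neg fun e => hu' ?_)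
    rw [e, if_neg h]
  · intro n hn m u hu
    by_contra hu'
    have h : ¬(n = n₀ ∨ n = n₁) := by rintro (rfl | rfl) <;> contradiction
    refine hu (Finset.sum_eq_zero fun r _ => if_neg fun e => hu' ?_)
    rw [e, if_neg h]
  · rw [sum_prWeight_left, sum_prWeight_left]
  · rw [sum_prWeight_right, sum_prWeight_right]

end Box

/-! ### Positivity of tensor product operators. -/

section TensorOperators

variable {I : Type*} [Fintype I] {H : I → Type*}
  [∀ i, NormedAddCommGroup (H i)] [∀ i, InnerProductSpace ℂ (H i)]
  {K : Type*} [NormedAddCommGroup K] [InnerProductSpace ℂ K] {τ : MultilinearMap ℂ H K}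

theorem IsTensorOperator.unique (hτ : IsHilbertTensorProduct τ) {A : ∀ i, H i →L[ℂ] H i}
    {S T : K →L[ℂ] K} (hS : IsTensorOperator τ A S) (hT : IsTensorOperator τ A T) : S = T := by
  refine ContinuousLinearMap.ext_on hτ.dense ?_
  rintro _ ⟨v, rfl⟩
  rw [hS v, hT v]

omit [Fintype I] in
theorem IsTensorOperator.comp {A B : ∀ i, H i →L[ℂ] H i} {S T : K →L[ℂ] K}
    (hS : IsTensorOperator τ A S) (hT : IsTensorOperator τ B T) :
    IsTensorOperator τ (fun i => A i ∘L B i) (S ∘L T) := by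
  intro v
  simp only [ContinuousLinearMap.comp_apply]
  rw [hT, hS]

theorem exists_isSelfAdjoint_sqrt {E : Type*} [NormedAddCommGroup E] [InnerProductSpace ℂ E]
    [CompleteSpace E] {A : E →L[ℂ] E} (hA : A.IsPositive) :
    ∃ R : E →L[ℂ] E, (∀ u v, ⟪R u, v⟫_ℂ = ⟪u, R v⟫_ℂ) ∧ ∀ u, R (R u) = A u := by
  have hA' := (ContinuousLinearMap.nonneg_iff_isPositive A).2 hA
  refine ⟨CFC.sqrt A, ?_, fun u => ?_⟩
  · exact ((ContinuousLinearMap.nonneg_iff_isPositive _).1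
      (CFC.sqrt_nonneg A)).inner_left_eq_inner_right
  · rw [← mul_apply_eq_comp, CFC.sqrt_mul_sqrt_self A hA']

theorem inner_self_eq_ofReal {E : Type*} [NormedAddCommGroup E] [InnerProductSpace ℂ E] (u : E) :
    ⟪u, u⟫_ℂ = ((‖u‖ ^ 2 : ℝ) : ℂ) := by
  rw [inner_self_eq_norm_sq_to_K]
  push_cast
  rfl

theorem IsTensorOperator.isPositive [∀ i, CompleteSpace (H i)] (hτ : IsHilbertTensorProduct τ)
    {A : ∀ i, H i →L[ℂ] H i} (hA : ∀ i, (A i).IsPositive) {T : K →L[ℂ] K}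
    (hT : IsTensorOperator τ A T) : T.IsPositive := by
  choose C hC hCC using fun i => exists_isSelfAdjoint_sqrt (hA i)
  rw [ContinuousLinearMap.isPositive_iff_complex]
  have key : ∀ u ∈ (Submodule.span ℂ (Set.range τ) : Set K),
      ∃ r : ℝ, 0 ≤ r ∧ ⟪T u, u⟫_ℂ = (r : ℂ) := by
    intro u hu
    obtain ⟨c, rfl⟩ := Finsupp.mem_span_range_iff_exists_finsupp.1 hu
    -- The quadratic form of `T` is the squared norm of the image under the square roots of the
    -- factors. This uses one representation of `u` only, so no bounded tensor product of the roots
    -- is needed.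
    refine ⟨‖c.sum fun v a => a • τ fun i => C i (v i)‖ ^ 2, by positivity, ?_⟩
    rw [← inner_self_eq_ofReal]
    simp only [Finsupp.sum, map_sum, map_smul, sum_inner, inner_sum, inner_smul_left,
      inner_smul_right]
    refine Finset.sum_congr rfl fun v _ => congrArg _ (Finset.sum_congr rfl fun w _ => ?_)
    rw [hT, hτ.inner_eq, hτ.inner_eq]
    congr 1
    refine Finset.prod_congr rfl fun i _ => ?_
    rw [← hCC, hC]
  have hclosed : IsClosed ({u : K | ((RCLike.re ⟪T u, u⟫_ℂ : ℝ) : ℂ) = ⟪T u, u⟫_ℂ} ∩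
      {u : K | 0 ≤ RCLike.re ⟪T u, u⟫_ℂ}) := by
    have h1 : Continuous fun u : K => ⟪T u, u⟫_ℂ := by fun_prop
    have h2 : Continuous fun u : K => RCLike.re ⟪T u, u⟫_ℂ := RCLike.continuous_re.comp h1
    exact (isClosed_eq (Complex.continuous_ofReal.comp h2) h1).inter
      (isClosed_le continuous_const h2)
  intro u
  refine hclosed.closure_subset_iff.2 (fun u hu => ?_) (hτ.dense u)
  obtain ⟨r, hr, h⟩ := key u hu
  simp [h, hr]

end TensorOperators

/-! ### Vanishing traces of products of positive operators. -/

section Trace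

variable {K : Type} [NormedAddCommGroup K] [InnerProductSpace ℂ K]

theorem HasTrace.unique [CompleteSpace K] {A : K →L[ℂ] K} {s t : ℂ} (hs : HasTrace A s)
    (ht : HasTrace A t) : s = t := by
  obtain ⟨w, b, -⟩ := exists_hilbertBasis ℂ K
  exact (hs w b).unique (ht w b)

theorem hasTrace_zero : HasTrace (0 : K →L[ℂ] K) 0 := by
  intro ι b
  simp

theorem hasTrace_sum {ι : Type*} (s : Finset ι) {A : ι → K →L[ℂ] K} {t : ι → ℂ}
    (h : ∀ i, HasTrace (A i) (t i)) : HasTrace (∑ i ∈ s, A i) (∑ i ∈ s, t i) := by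
  intro κ b
  simp only [sum_apply, inner_sum]
  exact hasSum_sum fun i _ => h i κ b

theorem hasSum_norm_inner_sq {ι : Type*} (b : HilbertBasis ι ℂ K) (x : K) :
    HasSum (fun i => ‖⟪b i, x⟫_ℂ‖ ^ 2) (‖x‖ ^ 2) := by
  have h := b.hasSum_inner_mul_inner x x
  rw [inner_self_eq_ofReal] at h
  have h2 : (fun i => ⟪x, b i⟫_ℂ * ⟪b i, x⟫_ℂ) = fun i => ((‖⟪b i, x⟫_ℂ‖ ^ 2 : ℝ) : ℂ) := by
    funext i
    rw [← inner_conj_symm, Complex.conj_mul']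
    push_cast
    rfl
  rw [h2] at h
  exact Complex.hasSum_ofReal.1 h

/-- With `C` and `R` square roots of `T` and `ρ`, the trace of `T ρ` equals that of `R T R`, the
squared Hilbert-Schmidt norm of `C R`. So `C R = 0`, and `T ρ = C (C R) R = 0`. -/
theorem comp_eq_zero_of_hasTrace_zero [CompleteSpace K] {T ρ : K →L[ℂ] K} (hT : T.IsPositive)
    (hρ : ρ.IsPositive) {t : ℂ} (ht : HasTrace ρ t) (h : HasTrace (T ∘L ρ) 0) :
    T ∘L ρ = 0 := by
  obtain ⟨C, hC, hCC⟩ := exists_isSelfAdjoint_sqrt hT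
  obtain ⟨R, hR, hRR⟩ := exists_isSelfAdjoint_sqrt hρ
  obtain ⟨w, b, -⟩ := exists_hilbertBasis ℂ K
  have hTs : ∀ u v, ⟪T u, v⟫_ℂ = ⟪u, T v⟫_ℂ := hT.inner_left_eq_inner_right
  have hsR : Summable fun k => ‖R (b k)‖ ^ 2 := by
    have h1 := (ht w b).summable
    have h2 : (fun k => ⟪b k, ρ (b k)⟫_ℂ) = fun k => ((‖R (b k)‖ ^ 2 : ℝ) : ℂ) := by
      funext k
      rw [← hRR, ← hR, inner_self_eq_ofReal]
    rw [h2] at h1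
    exact Complex.summable_ofReal.1 h1
  have hsTR : Summable fun k => ‖T (R (b k))‖ ^ 2 := by
    refine Summable.of_nonneg_of_le (fun k => by positivity) (fun k => ?_)
      (hsR.mul_left (‖T‖ ^ 2))
    rw [← mul_pow]
    exact pow_le_pow_left₀ (norm_nonneg _) (T.le_opNorm _) 2
  have hprod : ∀ f : w → K, (Summable fun k => ‖f k‖ ^ 2) →
      Summable fun x : w × w => ‖⟪b x.2, f x.1⟫_ℂ‖ ^ 2 := by
    intro f hf
    refine (summable_prod_of_nonneg fun x => by positivity).2 ⟨fun k => ?_, ?_⟩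
    · exact (hasSum_norm_inner_sq b (f k)).summable
    · simpa only [(hasSum_norm_inner_sq b (f _)).tsum_eq] using hf
  -- Summing this array in its two orders gives the traces of `R T R` and of `T ρ`. Exchanging them
  -- is legitimate because `R` and `T R` are Hilbert-Schmidt.
  let F : w × w → ℂ := fun x => ⟪R (b x.1), b x.2⟫_ℂ * ⟪b x.2, T (R (b x.1))⟫_ℂ
  have hF : Summable F := by
    refine Summable.of_norm_bounded ((hprod _ hsR).add (hprod _ hsTR)) fun x => ?_
    simp only [F, norm_mul]
    rw [norm_inner_symm]
    nlinarith [sq_nonneg (‖⟪b x.2, R (b x.1)⟫_ℂ‖ - ‖⟪b x.2, T (R (b x.1))⟫_ℂ‖),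
      sq_nonneg ‖⟪b x.2, R (b x.1)⟫_ℂ‖, sq_nonneg ‖⟪b x.2, T (R (b x.1))⟫_ℂ‖]
  have hcol : ∀ k, HasSum (fun j => F (k, j)) ⟪R (b k), T (R (b k))⟫_ℂ := fun k =>
    b.hasSum_inner_mul_inner (R (b k)) (T (R (b k)))
  have hrow : ∀ j, HasSum (fun k => F (k, j)) ⟪b j, (T ∘L ρ) (b j)⟫_ℂ := by
    intro j
    have h1 := b.hasSum_inner_mul_inner (R (T (b j))) (R (b j))
    rw [hR, hRR, hTs] at h1
    have h2 : ∀ k, F (k, j) = ⟪R (T (b j)), b k⟫_ℂ * ⟪b k, R (b j)⟫_ℂ := by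
      intro k
      simp only [F]
      rw [hR (T (b j)), hTs, hR, mul_comm]
    rw [funext h2, ContinuousLinearMap.comp_apply]
    exact h1
  have htot : ∑' x, F x = 0 := by
    have h1 := hF.prod_symm.hasSum.prod_fiberwise hrow
    rw [← h1.unique (h w b)]
    exact ((Equiv.prodComm w w).tsum_eq F).symm
  have hsum : HasSum (fun k => ⟪R (b k), T (R (b k))⟫_ℂ) 0 := by
    rw [← htot]
    exact hF.hasSum.prod_fiberwise hcol
  have hnorm : (fun k => ⟪R (b k), T (R (b k))⟫_ℂ) = fun k => ((‖C (R (b k))‖ ^ 2 : ℝ) : ℂ) := by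
    funext k
    rw [← hCC, ← hC, inner_self_eq_ofReal]
  rw [hnorm, ← Complex.ofReal_zero, Complex.hasSum_ofReal,
    hasSum_zero_iff_of_nonneg fun k => by positivity] at hsum
  have hCR : C ∘L R = 0 := by
    refine ContinuousLinearMap.ext_on (s := Set.range b) ?_ ?_
    · exact (Submodule.dense_iff_topologicalClosure_eq_top).2 b.dense_span
    · rintro _ ⟨k, rfl⟩
      simpa using congrFun hsum k
  ext u
  have := congrArg C (DFunLike.congr_fun hCR (R u))
  simpa [hCC, hRR] using this

end Trace

/-! ### No-signalling of quantum behaviours, and exclusion of the Popescu-Rohrlich box. -/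

section QuantumMarginals

variable {I : Type*} {M : I → Type*} [Fintype I] [DecidableEq I]
  {O : ∀ i, M i → Type*} [∀ i m, Fintype (O i m)]

/-- The local effects of a quantum model for the outputs `α` at the parties in `V`. -/
noncomputable def QuantumModel.effect (q : QuantumModel O) (V : Set I) (x : ∀ i, M i)
    (α : ∀ i m, O i m) (i : I) : q.H i →L[ℂ] q.H i :=
  if i ∈ V then q.E i (x i) (α i (x i)) else ContinuousLinearMap.id ℂ (q.H i)

variable {q : QuantumModel O} {T : ∀ x : (∀ i, M i), (∀ i, O i (x i)) → (q.K →L[ℂ] q.K)}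

omit [DecidableEq I] in
theorem QuantumModel.effect_congr {V : Set I} {x y : ∀ i, M i} (h : ∀ i ∈ V, x i = y i)
    (α : ∀ i m, O i m) : q.effect V x α = q.effect V y α := by
  funext i
  unfold effect
  split_ifs with hi
  · rw [h i hi]
  · rfl

omit [DecidableEq I] in
theorem QuantumModel.effect_isPositive (V : Set I) (x : ∀ i, M i) (α : ∀ i m, O i m) (i : I) :
    (q.effect V x α i).IsPositive := by
  unfold effect
  split_ifs
  · exact q.E_pos _ _ _
  · exact ContinuousLinearMap.isPositive_id

/-- The sum of the operators `T x b` over all outputs `b` that agree with `α` on `V`. -/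
noncomputable def marginalOperator (T : ∀ x : (∀ i, M i), (∀ i, O i (x i)) → (q.K →L[ℂ] q.K))
    (V : Set I) (x : ∀ i, M i) (α : ∀ i m, O i m) : q.K →L[ℂ] q.K :=
  ∑ b, if ∀ i ∈ V, b i = α i (x i) then T x b else 0

/-- Outside `V` the effects sum to the identity, and the tensor product is multilinear. -/
theorem isTensorOperator_marginalOperator
    (hT : ∀ x a, IsTensorOperator q.τ (fun i => q.E i (x i) (a i)) (T x a)) (V : Set I)
    (x : ∀ i, M i) (α : ∀ i m, O i m) :
    IsTensorOperator q.τ (q.effect V x α) (marginalOperator T V x α) := by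
  intro v
  let A : ∀ i, Finset (O i (x i)) := fun i => if i ∈ V then {α i (x i)} else Finset.univ
  have h1 : ∀ i, q.effect V x α i (v i) = ∑ o ∈ A i, q.E i (x i) o (v i) := by
    intro i
    by_cases hi : i ∈ V
    · simp [QuantumModel.effect, A, hi]
    · simp only [QuantumModel.effect, A, hi, if_false]
      rw [← q.E_sum i (x i), sum_apply]
  have h2 : ∀ b : (∀ i, O i (x i)), b ∈ Fintype.piFinset A ↔ ∀ i ∈ V, b i = α i (x i) := by
    intro b
    rw [Fintype.mem_piFinset]
    refine forall_congr' fun i => ?_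
    by_cases hi : i ∈ V <;> simp [A, hi]
  simp only [h1]
  rw [MultilinearMap.map_sum_finset, marginalOperator, sum_apply,
    ← Finset.sum_filter_add_sum_filter_not Finset.univ (fun b => b ∈ Fintype.piFinset A)]
  rw [Finset.sum_eq_zero (s := Finset.univ.filter fun b => ¬ b ∈ Fintype.piFinset A), add_zero,
    Finset.filter_univ_mem]
  · refine Finset.sum_congr rfl fun b hb => ?_
    rw [if_pos ((h2 b).1 hb), hT]
  · intro b hb
    rw [if_neg fun h => (Finset.mem_filter.1 hb).2 ((h2 b).2 h)]
    rfl

theorem hasTrace_marginalOperator {p : Table O} (hp : ∀ x a, HasTrace (T x a ∘L q.ρ) (p x a : ℂ))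
    (V : Set I) (x : ∀ i, M i) (α : ∀ i m, O i m) :
    HasTrace (marginalOperator T V x α ∘L q.ρ) (marginal p V x (fun i => α i (x i)) : ℂ) := by
  have := hasTrace_sum Finset.univ
    (A := fun b => (if ∀ i ∈ V, b i = α i (x i) then T x b else 0) ∘L q.ρ)
    (t := fun b => ((if ∀ i ∈ V, b i = α i (x i) then p x b else 0 : ℝ) : ℂ)) (fun b => by
      split_ifs
      · exact hp x b
      · simpa using hasTrace_zero)
  rw [marginal_eq_sum, Complex.ofReal_sum]
  rwa [← ContinuousLinearMap.finsetSum_comp] at this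

theorem marginalOperator_eq_of_eqOn
    (hT : ∀ x a, IsTensorOperator q.τ (fun i => q.E i (x i) (a i)) (T x a)) {V : Set I}
    {x y : ∀ i, M i} (h : ∀ i ∈ V, x i = y i) (α : ∀ i m, O i m) :
    marginalOperator T V x α = marginalOperator T V y α := by
  refine (isTensorOperator_marginalOperator hT V x α).unique q.isTensor ?_
  rw [QuantumModel.effect_congr h]
  exact isTensorOperator_marginalOperator hT V y α

theorem quantum_subset_noSignalling : quantum O ⊆ noSignalling O := by
  rintro p ⟨hp, q, hq⟩
  choose T hT htr using hq
  refine ⟨hp, fun i x y hxy α => ?_⟩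
  have h1 := hasTrace_marginalOperator htr {i}ᶜ x α
  have h2 := hasTrace_marginalOperator htr {i}ᶜ y α
  rw [marginalOperator_eq_of_eqOn hT (V := {i}ᶜ) (fun j hj => hxy j hj)] at h1
  exact_mod_cast h1.unique h2

omit [DecidableEq I] in
theorem comp_eq_zero_of_table_eq_zero {p : Table O}
    (hT : ∀ x a, IsTensorOperator q.τ (fun i => q.E i (x i) (a i)) (T x a))
    (hp : ∀ x a, HasTrace (T x a ∘L q.ρ) (p x a : ℂ)) {x : ∀ i, M i} {b : ∀ i, O i (x i)}
    (hb : p x b = 0) : T x b ∘L q.ρ = 0 := by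
  refine comp_eq_zero_of_hasTrace_zero ((hT x b).isPositive q.isTensor fun i => q.E_pos _ _ _)
    q.ρ_pos q.ρ_trace ?_
  simpa [hb] using hp x b

/-- On the support of the state, the operators of two events that occur together agree. -/
theorem marginalOperator_comp_eq {p : Table O}
    (hT : ∀ x a, IsTensorOperator q.τ (fun i => q.E i (x i) (a i)) (T x a))
    (hp : ∀ x a, HasTrace (T x a ∘L q.ρ) (p x a : ℂ)) {V W : Set I} {x : ∀ i, M i}
    {α β : ∀ i m, O i m} (h : ∀ b, p x b ≠ 0 →
      ((∀ i ∈ V, b i = α i (x i)) ↔ ∀ i ∈ W, b i = β i (x i))) :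
    marginalOperator T V x α ∘L q.ρ = marginalOperator T W x β ∘L q.ρ := by
  simp only [marginalOperator, ContinuousLinearMap.finsetSum_comp]
  refine Finset.sum_congr rfl fun b _ => ?_
  by_cases hb : p x b = 0
  · have h0 := comp_eq_zero_of_table_eq_zero hT hp hb
    split_ifs <;> simp [h0]
  · simp only [h b hb]

theorem marginalOperator_empty
    (hT : ∀ x a, IsTensorOperator q.τ (fun i => q.E i (x i) (a i)) (T x a)) (x : ∀ i, M i)
    (α : ∀ i m, O i m) : marginalOperator T ∅ x α = ContinuousLinearMap.id ℂ q.K := by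
  refine (isTensorOperator_marginalOperator hT ∅ x α).unique q.isTensor fun v => ?_
  simp [QuantumModel.effect]

theorem marginalOperator_pair
    (hT : ∀ x a, IsTensorOperator q.τ (fun i => q.E i (x i) (a i)) (T x a)) {i j : I} (hij : i ≠ j)
    (x : ∀ i, M i) (α : ∀ i m, O i m) :
    marginalOperator T {i, j} x α = marginalOperator T {i} x α ∘L marginalOperator T {j} x α := by
  refine (isTensorOperator_marginalOperator hT _ x α).unique q.isTensor ?_
  convert (isTensorOperator_marginalOperator hT {i} x α).comp
    (isTensorOperator_marginalOperator hT {j} x α) using 1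
  funext l
  by_cases hi : l = i
  · subst hi
    simp [QuantumModel.effect, hij]
  · by_cases hj : l = j
    · subst hj
      simp [QuantumModel.effect, hi]
    · simp [QuantumModel.effect, hi, hj]

/-- Write A and B for the effects of one bit value at `i` and `j`. Three perfect correlations give
A(m₁)ρ = B(n₀)ρ = A(m₀)ρ = B(n₁)ρ, while anticorrelation gives A(m₁)B(n₁)ρ = 0. Thus A(m₁)²ρ = 0, so
A(m₁)ρ = 0; summing over both bit values yields ρ = 0, against unit trace. -/
theorem prBox_notMem_quantum [∀ i, Nonempty (M i)] {enc : ∀ i m, Bool → O i m}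
    (henc : ∀ i m, Function.Injective (enc i m)) {i j : I} (hij : i ≠ j) {m₀ m₁ : M i}
    (hm : m₀ ≠ m₁) {n₀ n₁ : M j} (hn : n₀ ≠ n₁) :
    boxTable enc i j (prWeight m₀ m₁ n₀ n₁) ∉ quantum O := by
  rintro ⟨-, q, hq⟩
  choose T hT htr using hq
  let X : M i → M j → ∀ l, M l := fun m n =>
    Function.update (Function.update (fun l => Classical.arbitrary (M l)) i m) j n
  have hXi : ∀ m n, X m n i = m := fun m n => by simp [X, hij]
  have hXj : ∀ m n, X m n j = n := fun m n => by simp [X]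
  have hsupp : ∀ m n, m = m₀ ∨ m = m₁ → n = n₀ ∨ n = n₁ → ∀ b,
      boxTable enc i j (prWeight m₀ m₁ n₀ n₁) (X m n) b ≠ 0 → ∃ r : Bool,
        b i = enc i (X m n i) r ∧ b j = enc j (X m n j) (xor r (decide (m = m₁ ∧ n = n₁))) := by
    intro m n hm hn b hb
    simp only [boxTable, responseTable] at hb
    obtain ⟨u, -, hu⟩ := Finset.exists_ne_zero_of_sum_ne_zero hb
    have h1 : (fun l => bitOutput enc i j u l (X m n l)) = b := by
      by_contra h
      exact hu (if_neg h)
    rw [if_pos h1] at hu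
    simp only [prWeight] at hu
    obtain ⟨r, -, hr⟩ := Finset.exists_ne_zero_of_sum_ne_zero hu
    have h2 := (ite_ne_right_iff.1 hr).1
    rw [hXi, hXj, if_pos hm, if_pos hn] at h2
    refine ⟨r, ?_, ?_⟩
    · rw [← h1, h2]
      simp [bitOutput]
    · rw [← h1, h2]
      simp [bitOutput, hij.symm]
  let α : Bool → ∀ l m, O l m := fun u l m => enc l m u
  let S : Bool → Set I → M i → M j → (q.K →L[ℂ] q.K) := fun u V m n =>
    marginalOperator T V (X m n) (α u)
  have hSi : ∀ u m n n', S u {i} m n = S u {i} m n' := fun u m n n' =>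
    marginalOperator_eq_of_eqOn hT (by simp [hXi]) _
  have hSj : ∀ u m m' n, S u {j} m n = S u {j} m' n := fun u m m' n =>
    marginalOperator_eq_of_eqOn hT (by simp [hXj]) _
  have hcorr : ∀ u m n, m = m₀ ∨ m = m₁ → n = n₀ ∨ n = n₁ → ¬(m = m₁ ∧ n = n₁) →
      S u {i} m n ∘L q.ρ = S u {j} m n ∘L q.ρ := by
    intro u m n hm hn hmn
    refine marginalOperator_comp_eq hT htr fun b hb => ?_
    obtain ⟨r, h1, h2⟩ := hsupp m n hm hn b hb
    simp only [Set.mem_singleton_iff, forall_eq, h1, h2, α, (henc _ _).eq_iff]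
    simp [hmn]
  have hzero : ∀ u, S u {i, j} m₁ n₁ ∘L q.ρ = 0 := by
    intro u
    simp only [S, marginalOperator, ContinuousLinearMap.finsetSum_comp]
    refine Finset.sum_eq_zero fun b _ => ?_
    split_ifs with h
    · refine comp_eq_zero_of_table_eq_zero hT htr ?_
      by_contra hb
      obtain ⟨r, h1, h2⟩ := hsupp m₁ n₁ (Or.inr rfl) (Or.inr rfl) b hb
      have h3 := henc _ _ (h1.symm.trans (h i (by simp)))
      have h4 := henc _ _ (h2.symm.trans (h j (by simp)))
      subst h3
      simp at h4
    · simp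
  have hA : ∀ u, S u {i} m₁ n₁ ∘L q.ρ = 0 := by
    intro u
    have h1 : S u {i} m₁ n₁ ∘L q.ρ = S u {j} m₁ n₁ ∘L q.ρ := by
      rw [hSi u m₁ n₁ n₀, hcorr u m₁ n₀ (Or.inr rfl) (Or.inl rfl) (fun h => hn h.2),
        hSj u m₁ m₀ n₀, ← hcorr u m₀ n₀ (Or.inl rfl) (Or.inl rfl) (fun h => hn h.2),
        hSi u m₀ n₀ n₁, hcorr u m₀ n₁ (Or.inl rfl) (Or.inr rfl) (fun h => hm h.1),
        hSj u m₀ m₁ n₁]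
    have h2 : S u {i} m₁ n₁ ∘L S u {i} m₁ n₁ ∘L q.ρ = 0 := by
      rw [h1, ← ContinuousLinearMap.comp_assoc, ← hzero u]
      simp only [S, marginalOperator_pair hT hij]
    have h3 : (S u {i} m₁ n₁).IsPositive :=
      (isTensorOperator_marginalOperator hT _ _ _).isPositive q.isTensor
        (QuantumModel.effect_isPositive _ _ _)
    ext v
    have h4 : ⟪S u {i} m₁ n₁ (q.ρ v), S u {i} m₁ n₁ (q.ρ v)⟫_ℂ = 0 := by
      rw [h3.inner_left_eq_inner_right]
      have := DFunLike.congr_fun h2 v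
      simp only [ContinuousLinearMap.comp_apply] at this
      rw [this]
      simp
    simpa using h4
  have hρ : q.ρ = 0 := by
    have h1 : (S true {i} m₁ n₁ + S false {i} m₁ n₁) ∘L q.ρ = q.ρ := by
      have h2 : marginalOperator T ∅ (X m₁ n₁) (α true) ∘L q.ρ = q.ρ := by
        rw [marginalOperator_empty hT, ContinuousLinearMap.id_comp]
      refine Eq.trans ?_ h2
      simp only [S, marginalOperator, ContinuousLinearMap.add_comp,
        ContinuousLinearMap.finsetSum_comp]
      rw [← Finset.sum_add_distrib]
      refine Finset.sum_congr rfl fun b _ => ?_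
      by_cases hb : boxTable enc i j (prWeight m₀ m₁ n₀ n₁) (X m₁ n₁) b = 0
      · have h0 := comp_eq_zero_of_table_eq_zero hT htr hb
        split_ifs <;> simp [h0]
      · obtain ⟨r, h1, -⟩ := hsupp m₁ n₁ (Or.inr rfl) (Or.inr rfl) b hb
        cases r <;> simp [h1, α, (henc _ _).eq_iff]
    rw [← h1, ContinuousLinearMap.add_comp, hA, hA, add_zero]
  have := q.ρ_trace
  rw [hρ] at this
  exact zero_ne_one (hasTrace_zero.unique this)

end QuantumMarginals

/-! ### Concrete finite-dimensional tensor products. -/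

section EuclideanTensor

variable {I : Type*} [Fintype I] {D J : Type} [Fintype D] [Fintype J] [DecidableEq D]
  [DecidableEq J]

/-- The tensor product of copies of `ℂ ^ D`, with coordinates indexed by `J ≃ (I → D)`. -/
noncomputable def euclideanTensor (e : J ≃ (I → D)) :
    MultilinearMap ℂ (fun _ : I => EuclideanSpace ℂ D) (EuclideanSpace ℂ J) :=
  (WithLp.linearEquiv 2 ℂ (J → ℂ)).symm.toLinearMap.compMultilinearMap
    (MultilinearMap.pi fun j => (MultilinearMap.mkPiAlgebra ℂ I ℂ).compLinearMap
      fun i => (EuclideanSpace.proj (e j i) : EuclideanSpace ℂ D →L[ℂ] ℂ).toLinearMap)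

omit [Fintype D] [Fintype J] [DecidableEq D] [DecidableEq J] in
theorem euclideanTensor_apply (e : J ≃ (I → D)) (v : I → EuclideanSpace ℂ D) (j : J) :
    euclideanTensor e v j = ∏ i, v i (e j i) := by
  simp [euclideanTensor]

omit [Fintype D] [Fintype J] in
theorem euclideanTensor_single (e : J ≃ (I → D)) (s : I → D) :
    euclideanTensor e (fun i => EuclideanSpace.single (s i) 1) =
      EuclideanSpace.single (e.symm s) 1 := by
  ext j
  rw [euclideanTensor_apply]
  by_cases h : e j = s
  · subst h
    simp
  · obtain ⟨i, hi⟩ : ∃ i, e j i ≠ s i := by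
      by_contra! h'
      exact h (funext h')
    have hj : j ≠ e.symm s := fun h' => h (by simp [h'])
    rw [Finset.prod_eq_zero (Finset.mem_univ i) (by simp [hi])]
    simp [hj]

theorem isHilbertTensorProduct_euclideanTensor (e : J ≃ (I → D)) :
    IsHilbertTensorProduct (euclideanTensor e) where
  inner_eq v w := by
    simp only [PiLp.inner_apply, euclideanTensor_apply]
    rw [Finset.prod_univ_sum, Fintype.piFinset_univ, ← e.sum_comp]
    refine Finset.sum_congr rfl fun j _ => ?_
    simp only [RCLike.inner_apply, map_prod, ← Finset.prod_mul_distrib]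
  dense := by
    have h : Submodule.span ℂ (Set.range (euclideanTensor e)) = ⊤ := by
      rw [eq_top_iff, ← (EuclideanSpace.basisFun J ℂ).toBasis.span_eq]
      refine Submodule.span_mono ?_
      rintro _ ⟨j, rfl⟩
      refine ⟨fun i => EuclideanSpace.single (e j i) 1, ?_⟩
      rw [euclideanTensor_single]
      simp
    rw [h]
    exact dense_univ

/-- Define the operator on the product basis; two multilinear maps that agree on basis vectors are
equal. -/
theorem exists_isTensorOperator_euclideanTensor (e : J ≃ (I → D))
    (A : I → (EuclideanSpace ℂ D →L[ℂ] EuclideanSpace ℂ D)) :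
    ∃ T, IsTensorOperator (euclideanTensor e) A T := by
  let T : EuclideanSpace ℂ J →ₗ[ℂ] EuclideanSpace ℂ J :=
    (EuclideanSpace.basisFun J ℂ).toBasis.constr ℂ fun j =>
      euclideanTensor e fun i => A i (EuclideanSpace.single (e j i) 1)
  have hT : T.compMultilinearMap (euclideanTensor e) =
      (euclideanTensor e).compLinearMap fun i => (A i).toLinearMap := by
    refine Module.Basis.ext_multilinear (fun _ => (EuclideanSpace.basisFun D ℂ).toBasis) fun s => ?_
    simp only [LinearMap.compMultilinearMap_apply, OrthonormalBasis.coe_toBasis,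
      EuclideanSpace.basisFun_apply, MultilinearMap.compLinearMap_apply]
    rw [euclideanTensor_single]
    have := (EuclideanSpace.basisFun J ℂ).toBasis.constr_basis ℂ (fun j =>
      euclideanTensor e fun i => A i (EuclideanSpace.single (e j i) 1)) (e.symm s)
    simp only [OrthonormalBasis.coe_toBasis, EuclideanSpace.basisFun_apply,
      Equiv.apply_symm_apply] at this
    exact this
  refine ⟨T.toContinuousLinearMap, fun v => ?_⟩
  exact congrArg (fun f => f v) hT

theorem inner_toEuclideanLin_single (N : Matrix D D ℂ) (d d' : D) :
    ⟪(EuclideanSpace.single d 1 : EuclideanSpace ℂ D),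
      Matrix.toEuclideanLin N (EuclideanSpace.single d' 1)⟫_ℂ = N d d' := by
  rw [EuclideanSpace.inner_single_left]
  simp [Matrix.toLpLin_apply]

end EuclideanTensor

/-! ### Finite quantum models, and locality implies quantum. -/

section FiniteModels

variable {I : Type*} {M : I → Type*} [Fintype I] [DecidableEq I]
  {O : ∀ i, M i → Type*} [∀ i m, Fintype (O i m)]

/-- The state is the pure state with amplitude `κ c` on the product vector `s c`. Its normalization
need not be assumed: it follows from the normalization of `p`. -/
theorem mem_quantum_of_projections [∀ i, Nonempty (M i)] {p : Table O}
    (hp : p ∈ allBehaviours O) {D C : Type} [Fintype D] [DecidableEq D] [Fintype C]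
    (N : ∀ i m, O i m → Matrix D D ℝ) (hsymm : ∀ i m o, (N i m o).transpose = N i m o)
    (hproj : ∀ i m o, N i m o * N i m o = N i m o) (hsum : ∀ i m, ∑ o, N i m o = 1)
    (κ : C → ℝ) (s : C → I → D) (h : ∀ x a, p x a =
      ∑ c, ∑ c', κ c * κ c' * ∏ i, N i (x i) (a i) (s c i) (s c' i)) : p ∈ quantum O := by
  let e : Fin (Fintype.card (I → D)) ≃ (I → D) := (Fintype.equivFin (I → D)).symm
  let E : ∀ i m, O i m → (EuclideanSpace ℂ D →L[ℂ] EuclideanSpace ℂ D) := fun i m o =>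
    (Matrix.toEuclideanLin ((N i m o).map Complex.ofReal)).toContinuousLinearMap
  have hEpos : ∀ i m o, (E i m o).IsPositive := by
    intro i m o
    rw [LinearMap.isPositive_toContinuousLinearMap_iff, Matrix.isPositive_toEuclideanLin_iff]
    have h1 : ((N i m o).map Complex.ofReal).conjTranspose = (N i m o).map Complex.ofReal := by
      ext d d'
      simp [← congrFun₂ (hsymm i m o) d d', Matrix.transpose_apply]
    have h2 : (N i m o).map Complex.ofReal =
        ((N i m o).map Complex.ofReal).conjTranspose * (N i m o).map Complex.ofReal := by
      rw [h1]
      conv_lhs => rw [← hproj i m o]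
      exact Matrix.map_mul (f := Complex.ofRealHom)
    rw [h2]
    exact Matrix.posSemidef_conjTranspose_mul_self _
  have hEsum : ∀ i m, ∑ o, E i m o = ContinuousLinearMap.id ℂ (EuclideanSpace ℂ D) := by
    intro i m
    have h1 : ∑ o, (N i m o).map Complex.ofReal = 1 := by
      ext d d'
      have := congrArg Complex.ofReal (congrFun₂ (hsum i m) d d')
      simp only [Matrix.sum_apply, Complex.ofReal_sum] at this
      simp only [Matrix.sum_apply, Matrix.map_apply, this]
      by_cases hd : d = d' <;> simp [Matrix.one_apply, hd]
    simp only [E]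
    rw [← map_sum, ← map_sum, h1]
    ext v
    simp
  let ψ : EuclideanSpace ℂ (Fin (Fintype.card (I → D))) :=
    ∑ c, (κ c : ℂ) • euclideanTensor e fun i => EuclideanSpace.single (s c i) 1
  have hτ := isHilbertTensorProduct_euclideanTensor e
  have hinner : ∀ (A : I → (EuclideanSpace ℂ D →L[ℂ] EuclideanSpace ℂ D)) T,
      IsTensorOperator (euclideanTensor e) A T → ⟪ψ, T ψ⟫_ℂ = ∑ c, ∑ c', κ c * κ c' *
        ∏ i, ⟪(EuclideanSpace.single (s c i) 1 : EuclideanSpace ℂ D),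
          A i (EuclideanSpace.single (s c' i) 1)⟫_ℂ := by
    intro A T hT
    simp only [ψ, map_sum, map_smul, sum_inner, inner_sum, inner_smul_left, inner_smul_right,
      Complex.conj_ofReal, Finset.mul_sum]
    rw [Finset.sum_comm]
    refine Finset.sum_congr rfl fun c _ => Finset.sum_congr rfl fun c' _ => ?_
    rw [hT, hτ.inner_eq]
    ring
  have hborn : ∀ x a T, IsTensorOperator (euclideanTensor e) (fun i => E i (x i) (a i)) T →
      ⟪ψ, T ψ⟫_ℂ = p x a := by
    intro x a T hT
    rw [hinner _ T hT, h x a]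
    push_cast
    refine Finset.sum_congr rfl fun c _ => Finset.sum_congr rfl fun c' _ => ?_
    congr 1
    refine Finset.prod_congr rfl fun i _ => ?_
    exact inner_toEuclideanLin_single _ _ _
  have hexists := fun (x : ∀ i, M i) (a : ∀ i, O i (x i)) =>
    exists_isTensorOperator_euclideanTensor e fun i => E i (x i) (a i)
  have hψ : ⟪ψ, ψ⟫_ℂ = 1 := by
    choose T hT using hexists
    let x : ∀ i, M i := fun i => Classical.arbitrary _
    have h1 : IsTensorOperator (euclideanTensor e)
        (fun _ => ContinuousLinearMap.id ℂ (EuclideanSpace ℂ D)) (∑ a, T x a) := by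
      intro v
      rw [sum_apply]
      have h2 : ∀ i, ContinuousLinearMap.id ℂ (EuclideanSpace ℂ D) (v i) =
          ∑ o, E i (x i) o (v i) := fun i => by rw [← hEsum i (x i), sum_apply]
      simp only [h2]
      rw [MultilinearMap.map_sum]
      exact Finset.sum_congr rfl fun a _ => hT x a v
    have h2 : ∑ a, T x a = ContinuousLinearMap.id ℂ _ := h1.unique hτ fun v => rfl
    calc ⟪ψ, ψ⟫_ℂ = ⟪ψ, (∑ a, T x a) ψ⟫_ℂ := by rw [h2]; rfl
      _ = ∑ a, (p x a : ℂ) := by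
        rw [sum_apply, inner_sum]
        exact Finset.sum_congr rfl fun a _ => hborn x a _ (hT x a)
      _ = 1 := by
        rw [← Complex.ofReal_sum, hp.2 x, Complex.ofReal_one]
  have htrace : ∀ T : EuclideanSpace ℂ (Fin (Fintype.card (I → D))) →L[ℂ] _,
      HasTrace (T ∘L InnerProductSpace.rankOne ℂ ψ ψ) ⟪ψ, T ψ⟫_ℂ := by
    intro T ι b
    have h1 : ∀ j, ⟪b j, (T ∘L InnerProductSpace.rankOne ℂ ψ ψ) (b j)⟫_ℂ =
        ⟪ψ, b j⟫_ℂ * ⟪b j, T ψ⟫_ℂ := by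
      intro j
      rw [ContinuousLinearMap.comp_apply, InnerProductSpace.rankOne_apply, map_smul,
        inner_smul_right]
    rw [funext h1]
    exact b.hasSum_inner_mul_inner ψ (T ψ)
  have hone : HasTrace (InnerProductSpace.rankOne ℂ ψ ψ) 1 := by
    have := htrace (ContinuousLinearMap.id ℂ _)
    rwa [ContinuousLinearMap.id_comp, ContinuousLinearMap.id_apply, hψ] at this
  let q : QuantumModel O :=
    { H := fun _ => EuclideanSpace ℂ D
      K := EuclideanSpace ℂ (Fin (Fintype.card (I → D)))
      τ := euclideanTensor e
      isTensor := hτ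
      ρ := InnerProductSpace.rankOne ℂ ψ ψ
      ρ_pos := InnerProductSpace.isPositive_rankOne_self ψ
      ρ_trace := hone
      E := E
      E_pos := hEpos
      E_sum := hEsum }
  refine ⟨hp, q, fun x a => ?_⟩
  obtain ⟨T, hT⟩ := hexists x a
  refine ⟨T, hT, ?_⟩
  rw [← hborn x a T hT]
  exact htrace T

/-- The state is a superposition of the vectors |k, …, k⟩ over deterministic strategies `k`, with
amplitudes the square roots of their weights. Measurements read off `k`; being diagonal, they see no
cross terms. -/
theorem bellLocal_subset_quantum [Nonempty I] [∀ i, Finite (M i)] [∀ i, Nonempty (M i)] :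
    bellLocal O ⊆ quantum O := by
  have := fun i => Fintype.ofFinite (M i)
  intro p hp
  obtain ⟨hb, w, hw, rfl⟩ := mem_bellLocal_iff.1 hp
  let e := (Fintype.equivFin (∀ i m, O i m)).symm
  refine mem_quantum_of_projections hb (C := Fin (Fintype.card (∀ i m, O i m)))
    (fun i m o => Matrix.diagonal fun k => if e k i m = o then 1 else 0)
    (fun i m o => Matrix.diagonal_transpose _) (fun i m o => ?_) (fun i m => ?_)
    (fun k => Real.sqrt (w (e k))) (fun k _ => k) fun x a => ?_
  · rw [Matrix.diagonal_mul_diagonal]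
    congr 1
    funext k
    split_ifs <;> simp
  · ext k l
    by_cases hkl : k = l
    · subst hkl
      simp [Matrix.sum_apply]
    · simp [Matrix.sum_apply, hkl]
  · simp only [responseTable]
    rw [← e.sum_comp]
    refine Finset.sum_congr rfl fun k _ => ?_
    rw [Finset.sum_eq_single k]
    · simp only [Matrix.diagonal_apply_eq, Real.mul_self_sqrt (hw _)]
      rw [Finset.prod_ite_zero]
      simp only [id, funext_iff, Finset.mem_univ, true_implies]
      split_ifs <;> simp
    · intro l _ hl
      obtain ⟨i⟩ := ‹Nonempty I›
      rw [Finset.prod_eq_zero (Finset.mem_univ i), mul_zero]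
      exact Matrix.diagonal_apply_ne _ (Ne.symm hl)
    · simp

end FiniteModels

/-! ### Quantum violation of the Clauser-Horne inequality. -/

section Chsh

/-- The effect for the outcome `u` of the two-outcome measurement given by the projection `P`. -/
noncomputable def bitEffect {D : Type} [DecidableEq D] (P : Matrix D D ℝ) (u : Bool) :
    Matrix D D ℝ :=
  if u then P else 1 - P

/-- The joint distribution of the outcomes of the measurements `P` and `Q` on the two halves of a
maximally entangled pair of qubits. -/
noncomputable def entangledWeight (P Q : Matrix (Fin 2) (Fin 2) ℝ) (u : Bool × Bool) : ℝ :=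
  ∑ c, ∑ c', 1 / 2 * (bitEffect P u.1 c c' * bitEffect Q u.2 c c')

variable {I : Type*} {M : I → Type*} [Fintype I] [DecidableEq I]
  {O : ∀ i, M i → Type*} [∀ i m, Fintype (O i m)] {enc : ∀ i m, Bool → O i m}

theorem entangledBox_mem_quantum [∀ i, Nonempty (M i)]
    (henc : ∀ i m, Function.Injective (enc i m)) {i j : I} (hij : i ≠ j)
    (A : M i → Matrix (Fin 2) (Fin 2) ℝ) (B : M j → Matrix (Fin 2) (Fin 2) ℝ)
    (hA : ∀ m, (A m).transpose = A m ∧ A m * A m = A m)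
    (hB : ∀ n, (B n).transpose = B n ∧ B n * B n = B n)
    (hbox : boxTable enc i j (fun m n => entangledWeight (A m) (B n)) ∈ allBehaviours O) :
    boxTable enc i j (fun m n => entangledWeight (A m) (B n)) ∈ quantum O := by
  -- The parties other than `i` and `j` measure the identity, so they output `true` with certainty.
  let P : ∀ l, M l → Matrix (Fin 2) (Fin 2) ℝ :=
    Function.update (Function.update (fun _ _ => 1) i A) j B
  have hPi : P i = A := by simp [P, hij]
  have hPj : P j = B := by simp [P]
  have hPl : ∀ l m, l ≠ i → l ≠ j → P l m = 1 := fun l m h h' => by simp [P, h, h']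
  have hP : ∀ l m, (P l m).transpose = P l m ∧ P l m * P l m = P l m := by
    intro l m
    by_cases hi : l = i
    · subst hi
      rw [hPi]
      exact hA m
    · by_cases hj : l = j
      · subst hj
        rw [hPj]
        exact hB m
      · rw [hPl l m hi hj]
        simp
  let N : ∀ l m, O l m → Matrix (Fin 2) (Fin 2) ℝ := fun l m o =>
    ∑ u, if enc l m u = o then bitEffect (P l m) u else 0
  have hN : ∀ l m u, N l m (enc l m u) = bitEffect (P l m) u := by
    intro l m u
    cases u <;> simp [N, (henc l m).eq_iff]
  have hN0 : ∀ l m o, (∀ u, enc l m u ≠ o) → N l m o = 0 := by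
    intro l m o h
    simp [N, h]
  have hbit : ∀ l m u, (bitEffect (P l m) u).transpose = bitEffect (P l m) u ∧
      bitEffect (P l m) u * bitEffect (P l m) u = bitEffect (P l m) u := by
    intro l m u
    obtain ⟨h1, h2⟩ := hP l m
    cases u
    · simp [bitEffect, h1, h2, sub_mul, mul_sub]
    · simp [bitEffect, h1, h2]
  have hcase : ∀ l m o, N l m o = 0 ∨ ∃ u, enc l m u = o ∧ N l m o = bitEffect (P l m) u := by
    intro l m o
    by_cases h : ∃ u, enc l m u = o
    · obtain ⟨u, rfl⟩ := h
      exact Or.inr ⟨u, rfl, hN l m u⟩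
    · push Not at h
      exact Or.inl (hN0 l m o h)
  refine mem_quantum_of_projections hbox N (fun l m o => ?_) (fun l m o => ?_) (fun l m => ?_)
    -- A maximally entangled pair for `i` and `j`; all other parties hold the basis vector 0.
    (fun _ : Fin 2 => Real.sqrt (1 / 2)) (fun c l => if l = i ∨ l = j then c else 0) fun x a => ?_
  · rcases hcase l m o with h | ⟨u, -, h⟩
    · simp [h]
    · rw [h, (hbit l m u).1]
  · rcases hcase l m o with h | ⟨u, -, h⟩
    · simp [h]
    · rw [h, (hbit l m u).2]
  · simp only [N]
    rw [Finset.sum_comm]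
    simp [bitEffect]
  · simp only [boxTable, responseTable, Real.mul_self_sqrt (show (0 : ℝ) ≤ 1 / 2 by norm_num)]
    by_cases h : ∃ u, (fun l => bitOutput enc i j u l (x l)) = a
    · obtain ⟨u, rfl⟩ := h
      rw [Finset.sum_eq_single u]
      · rw [if_pos rfl, entangledWeight]
        refine Finset.sum_congr rfl fun c _ => Finset.sum_congr rfl fun c' _ => ?_
        rw [Finset.prod_eq_mul i j hij]
        · simp [bitOutput, hij.symm, hN, hPi, hPj]
        · intro l _ hl
          simp [bitOutput, hl.1, hl.2, hN, hPl l _ hl.1 hl.2, bitEffect]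
        · simp
        · simp
      · intro u' _ hu'
        refine if_neg fun h => hu' ?_
        have h1 := congrFun h i
        have h2 := congrFun h j
        simp only [bitOutput, if_true, hij.symm, if_false, (henc _ _).eq_iff] at h1 h2
        exact Prod.ext h1 h2
      · simp
    · rw [Finset.sum_eq_zero fun u _ => if_neg fun hu => h ⟨u, hu⟩]
      symm
      refine Finset.sum_eq_zero fun c _ => Finset.sum_eq_zero fun c' _ => ?_
      by_contra hne
      have hl : ∀ l, N l (x l) (a l) ≠ 0 := by
        intro l hl
        refine hne ?_
        rw [Finset.prod_eq_zero (Finset.mem_univ l) (by simp [hl]), mul_zero]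
      obtain ⟨u, hu, -⟩ := (hcase i (x i) (a i)).resolve_left (hl i)
      obtain ⟨v, hv, -⟩ := (hcase j (x j) (a j)).resolve_left (hl j)
      refine h ⟨(u, v), funext fun l => ?_⟩
      by_cases hi : l = i
      · subst hi
        simpa [bitOutput] using hu
      · by_cases hj : l = j
        · subst hj
          simpa [bitOutput, hi] using hv
        · obtain ⟨r, hr, hr'⟩ := (hcase l (x l) (a l)).resolve_left (hl l)
          cases r
          · refine absurd ?_ (hl l)
            simp [hr', hPl l _ hi hj, bitEffect]
          · simpa [bitOutput, hi, hj] using hr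

theorem exists_mem_quantum_notMem_partiallyDeterministic [∀ i, Nontrivial (M i)]
    (henc : ∀ i m, Function.Injective (enc i m)) {M' : ∀ i, Set (M i)} {i j : I} (hij : i ≠ j)
    {m₀ : M i} (hm₀ : m₀ ∈ M' i) :
    ∃ p ∈ quantum O, p ∉ partiallyDeterministic O M' := by
  obtain ⟨m₁, hm⟩ := exists_ne m₀
  obtain ⟨n₀, n₁, hn⟩ := exists_pair_ne (M j)
  -- Projections onto (1,0) and (1,1) for `i`, and onto (2,1) and (2,-1) for `j`: a choice with
  -- rational entries near the optimal angles. The joint terms are 2/5, 2/5, 9/20 and 1/20, the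
  -- marginals 1/2, so the Clauser-Horne value is 1/5.
  let A : M i → Matrix (Fin 2) (Fin 2) ℝ := fun m =>
    if m = m₀ then !![1, 0; 0, 0] else !![1 / 2, 1 / 2; 1 / 2, 1 / 2]
  let B : M j → Matrix (Fin 2) (Fin 2) ℝ := fun n =>
    if n = n₀ then !![4 / 5, 2 / 5; 2 / 5, 1 / 5] else !![4 / 5, -(2 / 5); -(2 / 5), 1 / 5]
  have hA : ∀ m, (A m).transpose = A m ∧ A m * A m = A m := by
    intro m
    simp only [A]
    split_ifs <;> constructor <;> ext c c' <;> fin_cases c <;> fin_cases c' <;>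
      norm_num [Matrix.mul_apply, Fin.sum_univ_two]
  have hB : ∀ n, (B n).transpose = B n ∧ B n * B n = B n := by
    intro n
    simp only [B]
    split_ifs <;> constructor <;> ext c c' <;> fin_cases c <;> fin_cases c' <;>
      norm_num [Matrix.mul_apply, Fin.sum_univ_two]
  have h0 : ∀ m n u, 0 ≤ entangledWeight (A m) (B n) u := by
    rintro m n ⟨u, v⟩
    simp only [A, B]
    split_ifs <;> cases u <;> cases v <;>
      norm_num [entangledWeight, bitEffect, Fin.sum_univ_two, Matrix.one_apply]
  have h1 : ∀ m n, ∑ u, entangledWeight (A m) (B n) u = 1 := by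
    intro m n
    rw [Fintype.sum_prod_type]
    simp only [A, B]
    split_ifs <;>
      norm_num [entangledWeight, bitEffect, Fin.sum_univ_two, Matrix.one_apply]
  refine ⟨boxTable enc i j fun m n => entangledWeight (A m) (B n),
    entangledBox_mem_quantum henc hij A B hA hB (boxTable_mem_allBehaviours h0 h1), fun hp => ?_⟩
  let X : M i → M j → ∀ l, M l := fun m n =>
    Function.update (Function.update (fun l => Classical.arbitrary (M l)) i m) j n
  have hXi : ∀ m n, X m n i = m := fun m n => by simp [X, hij]
  have hXj : ∀ m n, X m n j = n := fun m n => by simp [X]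
  have hmarg : ∀ V m n, marginal (boxTable enc i j fun m n => entangledWeight (A m) (B n)) V
      (X m n) (fun l => enc l (X m n l) true) =
        ∑ u : Bool × Bool, if (i ∈ V → u.1 = true) ∧ (j ∈ V → u.2 = true) then
          entangledWeight (A m) (B n) u else 0 := by
    intro V m n
    simp only [boxTable]
    rw [marginal_responseTable]
    refine Finset.sum_congr rfl fun u _ => ?_
    rw [hXi, hXj]
    congr 1
    refine propext ⟨fun h => ⟨fun hi => ?_, fun hj => ?_⟩, fun h l hl => ?_⟩
    · have := henc _ _ (h i hi)
      simpa using this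
    · have := henc _ _ (h j hj)
      simpa [hij.symm] using this
    · by_cases hi : l = i
      · subst hi
        simp [bitOutput, h.1 hl]
      · by_cases hj : l = j
        · subst hj
          simp [bitOutput, hi, h.2 hl]
        · simp [bitOutput, hi, hj]
  have h := clauserHorne_nonpos hp hm₀ m₁ n₀ n₁ X hXi hXj fun l m => enc l m true
  simp only [clauserHorne] at h
  simp only [hmarg, Fintype.sum_prod_type, Fintype.sum_bool] at h
  norm_num [hij, hij.symm, entangledWeight, bitEffect, Fin.sum_univ_two, A, B, hm, hn.symm] at h

end Chsh

end BellScenario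

/-! ### The trichotomy. -/

open BellScenario in
theorem mainTheorem7 {I : Type*} [Fintype I] [DecidableEq I] [Nontrivial I]
    (M : I → Type*) [∀ i, Finite (M i)] [∀ i, Nontrivial (M i)]
    (O : ∀ i, M i → Type*) [∀ i m, Fintype (O i m)] [∀ i m, Nontrivial (O i m)]
    (M' : ∀ i, Set (M i)) :
    BellScenario.ExactlyOne
      (BellScenario.partiallyDeterministic O M' = BellScenario.bellLocal O ∧
        BellScenario.bellLocal O ⊂ BellScenario.quantum O)
      (BellScenario.partiallyDeterministic O M' = BellScenario.noSignalling O ∧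
        BellScenario.quantum O ⊂ BellScenario.noSignalling O)
      (BellScenario.bellLocal O ≠ BellScenario.partiallyDeterministic O M' ∧
        BellScenario.partiallyDeterministic O M' ≠ BellScenario.noSignalling O ∧
        ¬ BellScenario.quantum O ⊆ BellScenario.partiallyDeterministic O M' ∧
        ¬ BellScenario.partiallyDeterministic O M' ⊆ BellScenario.quantum O) := by
  have := fun i => Fintype.ofFinite (M i)
  have henc : ∀ i m, ∃ f : Bool → O i m, Function.Injective f := by
    intro i m
    obtain ⟨a, b, hab⟩ := exists_pair_ne (O i m)
    refine ⟨fun u => cond u a b, fun u v h => ?_⟩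
    cases u <;> cases v <;> simp_all
  choose enc henc using henc
  obtain ⟨i₀, j₀, hij₀⟩ := exists_pair_ne I
  have hBQ : bellLocal O ⊆ quantum O := bellLocal_subset_quantum
  have hQN : quantum O ⊆ noSignalling O := quantum_subset_noSignalling
  have hBQ' : bellLocal O ⊂ quantum O := by
    refine ⟨hBQ, fun h => ?_⟩
    -- Local behaviours lie in PD for every choice of predictable inputs, so any nonempty choice
    -- gives a quantum behaviour that is not local.
    obtain ⟨p, hp, hp'⟩ := exists_mem_quantum_notMem_partiallyDeterministic henc
      (M' := fun _ => Set.univ) hij₀ (Set.mem_univ (Classical.arbitrary (M i₀)))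
    exact hp' (bellLocal_subset_partiallyDeterministic _ (h hp))
  have hPR : ∀ N : (∀ i, Set (M i)), ∀ i j, i ≠ j → ¬((N i)ᶜ).Subsingleton →
      ¬((N j)ᶜ).Subsingleton → ¬ partiallyDeterministic O N ⊆ quantum O := by
    intro N i j hij hi hj h
    obtain ⟨m₀, hm₀, m₁, hm₁, hm⟩ := Set.not_subsingleton_iff.1 hi
    obtain ⟨n₀, hn₀, n₁, hn₁, hn⟩ := Set.not_subsingleton_iff.1 hj
    exact prBox_notMem_quantum henc hij hm hn
      (h (prBox_mem_partiallyDeterministic hij hm₀ hm₁ hn₀ hn₁))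
  have hQN' : quantum O ⊂ noSignalling O := by
    refine ⟨hQN, fun h => ?_⟩
    refine hPR (fun _ => ∅) i₀ j₀ hij₀ ?_ ?_
      ((partiallyDeterministic_subset_noSignalling _).trans h) <;>
    · rw [Set.compl_empty]
      exact Set.not_subsingleton_iff.2 Set.nontrivial_univ
  have hBP : bellLocal O ⊆ partiallyDeterministic O M' :=
    bellLocal_subset_partiallyDeterministic M'
  have hBN : bellLocal O ≠ noSignalling O := (hBQ'.trans hQN').ne
  by_cases h1 : ∃ k, ∀ i, i ≠ k → ((M' i)ᶜ).Subsingleton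
  · obtain ⟨k, hk⟩ := h1
    have h : partiallyDeterministic O M' = bellLocal O :=
      (partiallyDeterministic_subset_bellLocal k hk).antisymm hBP
    exact Or.inl ⟨⟨h, hBQ'⟩, fun h' => hBN (h.symm.trans h'.1), fun h' => h'.1 h.symm⟩
  have hPQ : ¬ partiallyDeterministic O M' ⊆ quantum O := by
    push Not at h1
    obtain ⟨i, -, hi⟩ := h1 i₀
    -- Applying the negated condition at `i` itself yields a second party with two free inputs.
    obtain ⟨j, hji, hj⟩ := h1 i
    exact hPR M' j i hji (Set.not_subsingleton_iff.2 hj) (Set.not_subsingleton_iff.2 hi)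
  have hPB : partiallyDeterministic O M' ≠ bellLocal O := fun h => hPQ (h ▸ hBQ)
  by_cases h2 : ∀ i, M' i = ∅
  · have h : partiallyDeterministic O M' = noSignalling O :=
      (partiallyDeterministic_subset_noSignalling M').antisymm
        (noSignalling_subset_partiallyDeterministic h2)
    exact Or.inr (Or.inl ⟨fun h' => hPB h'.1, ⟨h, hQN'⟩, fun h' => h'.2.1 h⟩)
  · push Not at h2
    obtain ⟨i, m₀, hm₀⟩ := h2
    obtain ⟨j, hj⟩ := exists_ne i
    obtain ⟨p, hp, hp'⟩ := exists_mem_quantum_notMem_partiallyDeterministic henc hj.symm hm₀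
    have hPN : partiallyDeterministic O M' ≠ noSignalling O := fun h => hp' (h ▸ hQN hp)
    exact Or.inr (Or.inr ⟨fun h' => hPB h'.1, fun h' => hPN h'.1, hPB.symm, hPN,
      fun h => hp' (h hp), hPQ⟩)
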